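/- An MV-algebra is an algebra $\langle A,\oplus,\neg,0\rangle$ such that $\oplus$ is associative and commutative with neutral element $0$, and $\neg\neg x = x$, $x\oplus\neg 0=\neg 0$ and $\neg(\neg x\oplus y)\oplus y=\neg(\neg y\oplus x)\oplus x$ hold. Put $1:=\neg 0$, $x\to y:=\neg x\oplus y$, $x*y:=\neg(\neg x\oplus\neg y)$ and $x\vee y:=\neg(\neg x\oplus y)\oplus y$. A monadic MV-algebra is an MV-algebra with two unary operations $\exists,\forall$ satisfying the identities $\forall x\to x=1$, $\forall(x\to\forall y)=\exists x\to\forall y$, $\forall(\forall x\to y)=\forall x\to\forall y$, $\forall(\exists x\vee y)=\exists x\vee\forall y$ and $\exists(x*x)=\exists x*\exists x$. Let $\mathbb{MMV}$ be the class of all monadic MV-algebras. For $m,n\ge 1$ let $\mathbf{L}_m$ be the $(m+1)$-element Łukasiewicz chain $\{0,\frac1m,\dots,1\}$, with $x\oplus y=\min(1,x+y)$ and $\neg x=1-x$, and let $\langle\mathbf{L}_m^n,\exists_\vee,\forall_\wedge\rangle$ be its $n$-th power with pointwise MV-operations, where $\exists_\vee f$ and $\forall_\wedge f$ are the constant $n$-tuples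 whose value is the supremum, respectively the infimum, of the $n$ coordinates of $f$. A quasivariety is a class of algebras of the language $\{\oplus,\neg,0,\exists,\forall\}$ that is axiomatized by a set of quasi-identities $s_1=t_1\ \&\ \dots\ \&\ s_k=t_k\Rightarrow s=t$ ($k\ge 0$ finite). **Theorem.** $\mathbb{MMV}$ is generated as a quasivariety by the algebras $\langle\mathbf{L}_m^n,\exists_\vee,\forall_\wedge\rangle$, $m,n\ge1$; that is, $\mathbb{MMV}$ is the least quasivariety that contains all of them. -/

import Mathlib

universe u

/-! ### Quasi-identities and quasivarieties -/

/-- A quasi-identity `s₁ = t₁ & … & sₖ = tₖ ⇒ s = t` between terms of an algebraic language `L`,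
with finitely many (possibly zero) premises and variables `x₀, x₁, …`. -/
structure QuasiIdentity (L : FirstOrder.Language.{0, 0}) where
  /-- The finite list of premises, each pair `(sᵢ, tᵢ)` standing for `sᵢ = tᵢ`. -/
  premises : List (L.Term ℕ × L.Term ℕ)
  /-- The conclusion `s = t`, as a pair `(s, t)`. -/
  conclusion : L.Term ℕ × L.Term ℕ

/-- The algebra `A` satisfies the quasi-identity `q` (universally quantified over its variables). -/
def QuasiIdentity.HoldsIn {L : FirstOrder.Language.{0, 0}} (q : QuasiIdentity L)
    (A : CategoryTheory.Bundled.{u} L.Structure) : Prop :=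
  ∀ v : ℕ → A,
    (∀ e ∈ q.premises, e.1.realize v = e.2.realize v) →
      q.conclusion.1.realize v = q.conclusion.2.realize v

/-- A class of algebras is a quasivariety if it is the class of all algebras satisfying
some set of quasi-identities. -/
def IsQuasivariety {L : FirstOrder.Language.{0, 0}}
    (Q : Set (CategoryTheory.Bundled.{u} L.Structure)) : Prop :=
  ∃ T : Set (QuasiIdentity L), ∀ A, A ∈ Q ↔ ∀ q ∈ T, q.HoldsIn A

/-- The class `V` is generated as a quasivariety by the class `K`:
`V` is the least quasivariety that contains `K`. -/
def IsGeneratedAsQuasivarietyBy {L : FirstOrder.Language.{0, 0}}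
    (V K : Set (CategoryTheory.Bundled.{u} L.Structure)) : Prop :=
  IsLeast {Q | IsQuasivariety Q ∧ K ⊆ Q} V

namespace MonadicMV

/-! ### The language of monadic MV-algebras -/

/-- The basic operation symbols `0, ¬, ⊕, ∃, ∀`. -/
inductive Func : ℕ → Type
  | zero : Func 0
  | neg : Func 1
  | oplus : Func 2
  | ex : Func 1
  | all : Func 1

/-- The algebraic language `{0, ¬, ⊕, ∃, ∀}` of monadic MV-algebras. -/
def language : FirstOrder.Language.{0, 0} where
  Functions := Func
  Relations := fun _ => Empty

/-- Interpretations of `0, ¬, ⊕, ∃, ∀` on a type make it an algebra of the language. -/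
abbrev mkStructure {A : Type u} (zero : A) (neg : A → A) (oplus : A → A → A) (ex all : A → A) :
    language.Structure A where
  funMap
    | Func.zero, _ => zero
    | Func.neg, x => neg (x 0)
    | Func.oplus, x => oplus (x 0) (x 1)
    | Func.ex, x => ex (x 0)
    | Func.all, x => all (x 0)
  RelMap r _ := r.elim

section Operations

variable {A : Type u} [language.Structure A]

/-- The constant `0`. -/
def zero : A := FirstOrder.Language.Structure.funMap (L := language) Func.zero ![]

/-- The negation `¬x`. -/
def neg (x : A) : A := FirstOrder.Language.Structure.funMap (L := language) Func.neg ![x]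

/-- The truncated sum `x ⊕ y`. -/
def oplus (x y : A) : A := FirstOrder.Language.Structure.funMap (L := language) Func.oplus ![x, y]

/-- The quantifier `∃x`. -/
def ex (x : A) : A := FirstOrder.Language.Structure.funMap (L := language) Func.ex ![x]

/-- The quantifier `∀x`. -/
def all (x : A) : A := FirstOrder.Language.Structure.funMap (L := language) Func.all ![x]

/-- The constant `1 := ¬0`. -/
def one : A := neg zero

/-- The implication `x → y := ¬x ⊕ y`. -/
def imp (x y : A) : A := oplus (neg x) y

/-- The product `x * y := ¬(¬x ⊕ ¬y)`. -/
def mul (x y : A) : A := neg (oplus (neg x) (neg y))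

/-- The join `x ∨ y := ¬(¬x ⊕ y) ⊕ y`. -/
def sup (x y : A) : A := oplus (neg (oplus (neg x) y)) y

end Operations

/-! ### Monadic MV-algebras -/

/-- `⟨A, ⊕, ¬, 0⟩` is an MV-algebra. -/
structure IsMV (A : Type u) [language.Structure A] : Prop where
  oplus_assoc : ∀ x y z : A, oplus x (oplus y z) = oplus (oplus x y) z
  oplus_comm : ∀ x y : A, oplus x y = oplus y x
  oplus_zero : ∀ x : A, oplus x zero = x
  neg_neg : ∀ x : A, neg (neg x) = x
  oplus_neg_zero : ∀ x : A, oplus x (neg zero) = neg zero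
  lukasiewicz : ∀ x y : A,
    oplus (neg (oplus (neg x) y)) y = oplus (neg (oplus (neg y) x)) x

/-- `⟨A, ∃, ∀⟩` is a monadic MV-algebra. -/
structure IsMonadicMV (A : Type u) [language.Structure A] : Prop extends IsMV A where
  m1 : ∀ x : A, imp (all x) x = one
  m2 : ∀ x y : A, all (imp x (all y)) = imp (ex x) (all y)
  m3 : ∀ x y : A, all (imp (all x) y) = imp (all x) (all y)
  m4 : ∀ x y : A, all (sup (ex x) y) = sup (ex x) (all y)
  m5 : ∀ x : A, ex (mul x x) = mul (ex x) (ex x)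

/-- The class `MMV` of all monadic MV-algebras (with universe in `Type u`). -/
def MMV : Set (CategoryTheory.Bundled.{u} language.Structure) :=
  {A | IsMonadicMV A}

/-! ### The finite algebras `⟨Lₘⁿ, ∃_∨, ∀_∧⟩` -/

/-- The universe of the `(m + 1)`-element MV-chain `Lₘ`; the element `k` represents `k / m`, and
the order is that of `Fin (m + 1)`. -/
abbrev Chain (m : ℕ) : Type := Fin (m + 1)

/-- `¬x = 1 - x` in `Lₘ`. -/
def Chain.neg {m : ℕ} (x : Chain m) : Chain m := ⟨m - (x : ℕ), by omega⟩

/-- `x ⊕ y = min (x + y, 1)` in `Lₘ`. -/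
def Chain.oplus {m : ℕ} (x y : Chain m) : Chain m := ⟨min ((x : ℕ) + (y : ℕ)) m, by omega⟩

/-- The algebra `⟨Lₘⁿ, ∃_∨, ∀_∧⟩`: the MV-operations are pointwise, `∃_∨ f` and `∀_∧ f` are the
constant functions with value the supremum, respectively the infimum, of the values of `f`. -/
noncomputable instance powerStructure (m n : ℕ) : language.Structure (Fin n → Chain m) :=
  mkStructure (fun _ => 0) (fun f i => Chain.neg (f i)) (fun f g i => Chain.oplus (f i) (g i))
    (fun f _ => Finset.univ.sup f) (fun f _ => Finset.univ.inf f)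

/-- The copy of `⟨Lₘⁿ, ∃_∨, ∀_∧⟩` whose universe lies in `Type u`. -/
noncomputable def power (m n : ℕ) : CategoryTheory.Bundled.{u} language.Structure where
  α := ULift.{u} (Fin n → Chain m)
  str := Equiv.ulift.symm.inducedStructure

end MonadicMV

/-! ### MV-algebras -/

/-! A quasi-identity involves finitely many terms, so its failure in a monadic MV-algebra `A` is
witnessed on a finite set `S` of values. It fails in some Lₘⁿ as well once `S` is mapped there so
that every operation with arguments and value in `S` is preserved and two given elements `s ≠ t`
stay distinct (`exists_partial_embedding`).

The coordinates come from prime filters. Let `Q₀` be a prime filter omitting `∀(s → t)`. For each of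
finitely many `x` there is a prime filter `Q x` that contains `x → ∀x` and agrees with `Q₀` on the
subalgebra of fixed elements `∀z = z` (`exists_isPrime_witness`). It exists because `∃(x → ∀x) = 1`
and `∃` commutes with squaring, so powers of `x → ∀x` force no new fixed elements. Modulo `Q x` the
elements `x` and `∀x` coincide, hence the infimum is attained; applied to `¬x`, the same gives the
supremum for `∃`. All the quotients are chains over one common chain of fixed elements.

Each chain lies in its Chang group, whose divisible hull is an ordered rational vector space. In the
sum of these spaces amalgamated over the common subspace, the nonzero nonnegative vectors map to a
salient cone, so some rational functional is positive on finitely many of them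
(`exists_linearMap_pos`, `exists_compatible_linearMap`). Its restrictions agree on fixed elements,
so quantified elements become constant tuples. Clearing denominators gives `m`; the number of
filters is `n`. -/

/-- An MV-algebra, with `⊕` written `+` and `¬` written `ᶜ`. -/
class MVAlgebra (A : Type u) extends AddCommMonoid A, Compl A where
  compl_compl' : ∀ x : A, xᶜᶜ = x
  add_compl_zero' : ∀ x : A, x + 0ᶜ = 0ᶜ
  lukasiewicz' : ∀ x y : A, (xᶜ + y)ᶜ + y = (yᶜ + x)ᶜ + x

namespace MVAlgebra

section Basic

variable {A : Type u} [MVAlgebra A]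

instance : One A := ⟨0ᶜ⟩

instance : Mul A := ⟨fun x y => (xᶜ + yᶜ)ᶜ⟩

theorem one_def : (1 : A) = 0ᶜ := rfl

theorem mul_def (x y : A) : x * y = (xᶜ + yᶜ)ᶜ := rfl

@[simp] theorem compl_compl (x : A) : xᶜᶜ = x := compl_compl' x

@[simp] theorem compl_zero : (0 : A)ᶜ = 1 := rfl

@[simp] theorem compl_one : (1 : A)ᶜ = 0 := compl_compl' 0

@[simp] theorem add_one (x : A) : x + 1 = 1 := add_compl_zero' x

@[simp] theorem one_add (x : A) : 1 + x = 1 := by rw [add_comm, add_one]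

theorem compl_mul (x y : A) : (x * y)ᶜ = xᶜ + yᶜ := compl_compl _

theorem compl_add (x y : A) : (x + y)ᶜ = xᶜ * yᶜ := by simp [mul_def]

theorem compl_inj {x y : A} (h : xᶜ = yᶜ) : x = y := by
  rw [← compl_compl x, h, compl_compl]

instance : CommMonoid A where
  mul_assoc x y z := by simp [mul_def, add_assoc]
  mul_comm x y := by simp [mul_def, add_comm]
  one_mul x := by simp [mul_def]
  mul_one x := by simp [mul_def]

@[simp] theorem compl_add_self (x : A) : xᶜ + x = 1 := by
  have h := lukasiewicz' x 1
  simpa using h.symm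

@[simp] theorem mul_compl_self (x : A) : x * xᶜ = 0 := by simp [mul_def]

/-- The summand `(yᶜ + x)ᶜ` is the truncated difference `y ⊖ x`. The hypothesis is the unfolded form
of `x ≤ y`, because the order instance rests on this lemma. -/
theorem exists_eq_add {x y : A} (h : xᶜ + y = 1) : y = x + (yᶜ + x)ᶜ := by
  have := lukasiewicz' x y
  rw [h, compl_one, zero_add] at this
  rw [add_comm]
  exact this

instance : PartialOrder A where
  le x y := xᶜ + y = 1
  le_refl := compl_add_self
  le_trans x y z h₁ h₂ := by
    rw [exists_eq_add h₂, exists_eq_add h₁, ← add_assoc, ← add_assoc, compl_add_self, one_add,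
      one_add]
  le_antisymm x y h₁ h₂ := by
    have := lukasiewicz' x y
    rw [h₁, h₂] at this
    simpa using this.symm

theorem le_iff {x y : A} : x ≤ y ↔ xᶜ + y = 1 := Iff.rfl

theorem eq_add_of_le {x y : A} (h : x ≤ y) : y = x + (yᶜ + x)ᶜ := exists_eq_add h

theorem le_add_right' (x y : A) : x ≤ x + y := by
  rw [le_iff, ← add_assoc, compl_add_self, one_add]

theorem le_add_left' (x y : A) : x ≤ y + x := add_comm x y ▸ le_add_right' x y

theorem zero_le' (x : A) : 0 ≤ x := by simp [le_iff]

theorem le_one' (x : A) : x ≤ 1 := by simp [le_iff]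

theorem one_le_iff {x : A} : 1 ≤ x ↔ x = 1 := by simp [le_iff]

instance : IsOrderedAddMonoid A where
  add_le_add_left x y h z := by
    rw [eq_add_of_le h, add_right_comm]
    exact le_add_right' _ _

theorem compl_le_compl {x y : A} (h : x ≤ y) : yᶜ ≤ xᶜ := by
  rw [le_iff, compl_compl, add_comm]
  exact h

theorem mul_le_iff {x y z : A} : x * y ≤ z ↔ x ≤ yᶜ + z := by
  rw [le_iff, le_iff, compl_mul, add_assoc]

instance : IsOrderedMonoid A where
  mul_le_mul_left x y h z := by
    rw [mul_def, mul_def]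
    exact compl_le_compl (add_le_add_left (compl_le_compl h) _)

theorem mul_le_left' (x y : A) : x * y ≤ x := by
  rw [mul_le_iff]
  exact le_add_left' _ _

theorem mul_le_right' (x y : A) : x * y ≤ y := by
  rw [mul_comm]
  exact mul_le_left' _ _

theorem mul_imp_le (x y : A) : x * (xᶜ + y) ≤ y := by
  rw [mul_comm, mul_le_iff]

instance : SemilatticeSup A where
  sup x y := (xᶜ + y)ᶜ + y
  le_sup_left x y := by
    rw [lukasiewicz']
    exact le_add_left' _ _
  le_sup_right x y := le_add_left' _ _
  sup_le x y z hx hy := by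
    rw [eq_add_of_le hy, add_comm]
    exact add_le_add_right (compl_le_compl (add_le_add_left (compl_le_compl hx) _)) _

theorem sup_def (x y : A) : x ⊔ y = (xᶜ + y)ᶜ + y := rfl

/-- When `x ≤ yᶜ` the sum `x + y` is not truncated, so subtracting `y`, which is multiplying by
`yᶜ`, recovers `x`. -/
theorem add_mul_compl_of_le {x y : A} (h : x ≤ yᶜ) : (x + y) * yᶜ = x := by
  have h' : y ≤ xᶜ := by simpa using compl_le_compl h
  have := eq_add_of_le h'
  apply compl_inj
  rw [this, compl_mul, compl_compl, compl_compl, add_comm]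

/-- Dually, `x * y` is the difference of `x` and `yᶜ`, and adding `yᶜ` back restores `x`. -/
theorem mul_add_compl_of_le {x y : A} (h : yᶜ ≤ x) : x * y + yᶜ = x := by
  have := eq_add_of_le h
  rw [mul_def, add_comm]
  exact this.symm

theorem le_compl_iff {x y : A} : x ≤ yᶜ ↔ x * y = 0 := by
  rw [← add_zero yᶜ, ← mul_le_iff]
  exact ⟨fun h => le_antisymm h (zero_le' _), fun h => h.le⟩

theorem compl_le_iff {x y : A} : xᶜ ≤ y ↔ x + y = 1 := by
  rw [le_iff, compl_compl]

theorem add_inf_compl (x z : A) : x + xᶜ * (x + z) = x + z := by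
  have := mul_add_compl_of_le (x := x + z) (y := xᶜ) (by simpa using le_add_right' x z)
  rwa [compl_compl, add_comm, mul_comm] at this

/-- The element `z` splits as `(z ∧ xᶜ) + x * z`, and `x + (z ∧ xᶜ)` is already `x + z`; adding the
overflow `x * z` changes nothing. -/
theorem add_add_mul (x z : A) : x + z + x * z = x + z := by
  have h : z * (zᶜ + xᶜ) + x * z = z := by
    have := mul_add_compl_of_le (x := z) (y := zᶜ + xᶜ)
      (by rw [compl_add, compl_compl, compl_compl]; exact mul_le_left' _ _)
    rwa [compl_add, compl_compl, compl_compl, mul_comm z x] at this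
  have h' : z * (zᶜ + xᶜ) = xᶜ * (x + z) := by
    have := congrArg (·ᶜ) (lukasiewicz' zᶜ x)
    simp only [compl_add, compl_compl] at this
    rw [mul_comm z, mul_comm xᶜ, ← compl_compl (x + z), compl_add, ← compl_compl (zᶜ + xᶜ),
      compl_add, compl_compl, compl_compl, mul_comm z x, mul_comm xᶜ zᶜ]
    exact this.symm
  calc x + z + x * z = x + xᶜ * (x + z) + x * z := by rw [add_inf_compl]
    _ = x + (z * (zᶜ + xᶜ) + x * z) := by rw [h', add_assoc]
    _ = x + z := by rw [h]

/-- Prelinearity. -/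
theorem imp_sup_imp (x y : A) : (xᶜ + y) ⊔ (yᶜ + x) = 1 := by
  have h : (xᶜ + y)ᶜ + (yᶜ + x) = yᶜ + x := by
    have := add_add_mul x yᶜ
    rw [compl_add, compl_compl, add_comm yᶜ x, add_comm]
    exact this
  rw [sup_def, h, compl_add_self]

end Basic

end MVAlgebra

namespace MVAlgebra

/-! ### Filters and quotients -/

/-- An implicative filter of an MV-algebra. -/
structure Filt (A : Type u) [MVAlgebra A] where
  carrier : Set A
  one_mem : 1 ∈ carrier
  mp : ∀ {x y : A}, x ∈ carrier → xᶜ + y ∈ carrier → y ∈ carrier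

namespace Filt

variable {A : Type u} [MVAlgebra A] (F : Filt A)

theorem mem_of_le {x y : A} (hx : x ∈ F.carrier) (h : x ≤ y) : y ∈ F.carrier :=
  F.mp hx (by rw [le_iff.1 h]; exact F.one_mem)

theorem mul_mem {x y : A} (hx : x ∈ F.carrier) (hy : y ∈ F.carrier) : x * y ∈ F.carrier :=
  F.mp hy (F.mem_of_le hx (mul_le_iff.1 le_rfl))

/-- A filter is prime if it contains one of the members of each join that it contains. -/
def IsPrime : Prop := ∀ x y : A, x ⊔ y ∈ F.carrier → x ∈ F.carrier ∨ y ∈ F.carrier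

theorem sup_mul_le {x y z t : A} (hx : x * z ≤ t) (hy : y * z ≤ t) : (x ⊔ y) * z ≤ t :=
  mul_le_iff.2 (sup_le (mul_le_iff.1 hx) (mul_le_iff.1 hy))

/-- The filter of all `x` with `x ⊔ z ∈ F`. -/
def residual (z : A) : Filt A where
  carrier := {x | x ⊔ z ∈ F.carrier}
  one_mem := F.mem_of_le F.one_mem le_sup_left
  mp {x y} hx hy := by
    refine F.mem_of_le (F.mul_mem hx hy) (sup_mul_le ?_ ?_)
    · rw [mul_comm]
      refine sup_mul_le ?_ ?_
      · rw [mul_comm]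
        exact (mul_imp_le _ _).trans le_sup_left
      · exact (mul_le_left' _ _).trans le_sup_right
    · exact (mul_le_left' _ _).trans le_sup_right

/-- The prime filter theorem. -/
theorem exists_isPrime_disjoint (I : Set A) (hI : ∀ x ∈ I, ∀ y ∈ I, x ⊔ y ∈ I)
    (hF : Disjoint F.carrier I) :
    ∃ Q : Filt A, F.carrier ⊆ Q.carrier ∧ Disjoint Q.carrier I ∧ Q.IsPrime := by
  let S : Set (Set A) := {s | ∃ G : Filt A, G.carrier = s ∧ Disjoint s I}
  obtain ⟨m, hFm, hm⟩ := zorn_subset_nonempty S (by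
    intro c hc hchain hne
    refine ⟨⋃₀ c, ⟨⟨⋃₀ c, ?_, ?_⟩, rfl, ?_⟩, fun s hs => Set.subset_sUnion_of_mem hs⟩
    · obtain ⟨s, hs⟩ := hne
      obtain ⟨G, rfl, -⟩ := hc hs
      exact ⟨_, hs, G.one_mem⟩
    · rintro x y ⟨s, hs, hxs⟩ ⟨t, ht, hyt⟩
      rcases hchain.total hs ht with h | h
      · obtain ⟨G, rfl, -⟩ := hc ht
        exact ⟨_, ht, G.mp (h hxs) hyt⟩
      · obtain ⟨G, rfl, -⟩ := hc hs
        exact ⟨_, hs, G.mp hxs (h hyt)⟩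
    · rw [Set.disjoint_sUnion_left]
      intro s hs
      exact (hc hs).choose_spec.2) F.carrier ⟨F, rfl, hF⟩
  obtain ⟨Q, rfl, hQ⟩ := hm.prop
  refine ⟨Q, hFm, hQ, fun x y hxy => ?_⟩
  -- The filter `Q.residual w` contains `Q` and also `z`, so by maximality of `Q` it meets `I`. Two
  -- applications put a join of elements of `I` into `Q`.
  have key : ∀ (z w : A), z ⊔ w ∈ Q.carrier → z ∉ Q.carrier →
      ∃ c ∈ I, c ⊔ w ∈ Q.carrier := by
    intro z w hzw hz
    by_contra! hno
    have hle : Q.carrier ⊆ (Q.residual w).carrier := fun t ht => Q.mem_of_le ht le_sup_left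
    have := hm.le_of_ge (y := (Q.residual w).carrier)
      ⟨_, rfl, Set.disjoint_left.2 fun t ht htI => hno t htI ht⟩ hle
    exact hz (this hzw)
  by_contra! h
  obtain ⟨c, hc, hcy⟩ := key x y hxy h.1
  rw [sup_comm] at hcy
  obtain ⟨d, hd, hdc⟩ := key y c hcy h.2
  exact Set.disjoint_left.1 hQ hdc (hI d hd c hc)

theorem IsPrime.total {F : Filt A} (hF : F.IsPrime) (x y : A) :
    xᶜ + y ∈ F.carrier ∨ yᶜ + x ∈ F.carrier :=
  hF _ _ (by rw [imp_sup_imp]; exact F.one_mem)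

/-- The congruence of a filter. -/
def setoid : Setoid A where
  r x y := xᶜ + y ∈ F.carrier ∧ yᶜ + x ∈ F.carrier
  iseqv := by
    have trans : ∀ {x y z : A}, xᶜ + y ∈ F.carrier → yᶜ + z ∈ F.carrier →
        xᶜ + z ∈ F.carrier := by
      intro x y z h₁ h₂
      refine F.mem_of_le (F.mul_mem h₁ h₂) ?_
      rw [← mul_le_iff, mul_right_comm, mul_comm _ x]
      exact (mul_le_mul_left (mul_imp_le _ _) _).trans (mul_imp_le _ _)
    refine ⟨fun x => ?_, fun h => ⟨h.2, h.1⟩, fun h₁ h₂ => ⟨trans h₁.1 h₂.1, trans h₂.2 h₁.2⟩⟩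
    rw [compl_add_self]
    exact ⟨F.one_mem, F.one_mem⟩

/-- The quotient of an MV-algebra by a filter. -/
def Quo : Type u := Quotient F.setoid

/-- The class of an element in the quotient by a filter. -/
def proj (x : A) : F.Quo := Quotient.mk F.setoid x

theorem add_imp_add {x y x' y' : A} (hx : xᶜ + x' ∈ F.carrier) (hy : yᶜ + y' ∈ F.carrier) :
    (x + y)ᶜ + (x' + y') ∈ F.carrier := by
  refine F.mem_of_le (F.mul_mem hx hy) ?_
  have hx' : x ≤ (xᶜ + x')ᶜ + x' := mul_le_iff.1 (mul_imp_le _ _)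
  have hy' : y ≤ (yᶜ + y')ᶜ + y' := mul_le_iff.1 (mul_imp_le _ _)
  rw [← mul_le_iff, mul_comm, mul_le_iff, compl_mul, add_add_add_comm]
  exact add_le_add hx' hy'

instance : Zero F.Quo := ⟨F.proj 0⟩

instance : Add F.Quo := ⟨Quotient.map₂ (· + ·) fun _ _ hx _ _ hy =>
  ⟨F.add_imp_add hx.1 hy.1, F.add_imp_add hx.2 hy.2⟩⟩

instance : Compl F.Quo := ⟨Quotient.map (·ᶜ) fun x y h => by
  refine ⟨?_, ?_⟩
  · rw [compl_compl, add_comm]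
    exact h.2
  · rw [compl_compl, add_comm]
    exact h.1⟩

instance : MVAlgebra F.Quo where
  nsmul := nsmulRec
  add_assoc := by
    rintro ⟨x⟩ ⟨y⟩ ⟨z⟩
    exact congrArg F.proj (add_assoc x y z)
  add_comm := by
    rintro ⟨x⟩ ⟨y⟩
    exact congrArg F.proj (add_comm x y)
  zero_add := by
    rintro ⟨x⟩
    exact congrArg F.proj (zero_add x)
  add_zero := by
    rintro ⟨x⟩
    exact congrArg F.proj (add_zero x)
  compl_compl' := by
    rintro ⟨x⟩
    exact congrArg F.proj (compl_compl' x)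
  add_compl_zero' := by
    rintro ⟨x⟩
    exact congrArg F.proj (add_compl_zero' x)
  lukasiewicz' := by
    rintro ⟨x⟩ ⟨y⟩
    exact congrArg F.proj (lukasiewicz' x y)

theorem proj_add (x y : A) : F.proj (x + y) = F.proj x + F.proj y := rfl

theorem proj_compl (x : A) : F.proj xᶜ = (F.proj x)ᶜ := rfl

theorem proj_le_proj {x y : A} : F.proj x ≤ F.proj y ↔ xᶜ + y ∈ F.carrier := by
  rw [le_iff, ← proj_compl, ← proj_add]
  constructor
  · intro h
    have := (Quotient.exact (s := F.setoid) h).2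
    exact F.mp F.one_mem this
  · intro h
    refine Quotient.sound (s := F.setoid) ⟨?_, ?_⟩
    · change _ + 1 ∈ _
      rw [add_one]
      exact F.one_mem
    · change 1ᶜ + _ ∈ _
      rwa [compl_one, zero_add]

end Filt

end MVAlgebra

/-! ### Totally ordered MV-algebras. -/

/-- A totally ordered MV-algebra. -/
class MVChain (C : Type u) extends MVAlgebra C where
  total' : ∀ x y : C, x ≤ y ∨ y ≤ x

namespace MVChain

open MVAlgebra

/-- The quotient by a prime filter is a chain. -/
abbrev ofPrime {A : Type u} [MVAlgebra A] (F : Filt A) (hF : F.IsPrime) : MVChain F.Quo where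
  total' := by
    rintro ⟨x⟩ ⟨y⟩
    exact (hF.total x y).imp F.proj_le_proj.2 F.proj_le_proj.2

variable {C : Type u} [MVChain C]

theorem mul_eq_zero_of_add_ne_one {a b : C} (h : a + b ≠ 1) : a * b = 0 := by
  rw [← le_compl_iff]
  refine (total' a bᶜ).resolve_right fun h' => h ?_
  rw [add_comm, ← compl_le_iff]
  exact h'

/-- A sum equal to `1` acts as a carry in Chang's group. Here neither `a + b` nor `b + d` carries,
and both sides are the truncation of `a + b + d - 1` at `0`. This and the next two identities are
the cases of associativity. -/
theorem add_mul_eq_mul_add {a b d : C} (hab : a + b ≠ 1) (hbd : b + d ≠ 1) :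
    (a + b) * d = a * (b + d) := by
  have ha : (a + b) * bᶜ = a := add_mul_compl_of_le (le_compl_iff.2 (mul_eq_zero_of_add_ne_one hab))
  have hd : (d + b) * bᶜ = d := add_mul_compl_of_le
    (le_compl_iff.2 (mul_eq_zero_of_add_ne_one (by rwa [add_comm])))
  calc (a + b) * d = (a + b) * ((d + b) * bᶜ) := by rw [hd]
    _ = (a + b) * bᶜ * (b + d) := by rw [add_comm d b, mul_comm (b + d), mul_assoc]
    _ = a * (b + d) := by rw [ha]

theorem mul_add_eq_add_mul {a b d : C} (hab : a + b = 1) (hbd : b + d = 1) :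
    a * b + d = a + b * d := by
  have ha : a * b + bᶜ = a := mul_add_compl_of_le (compl_le_iff.2 (by rwa [add_comm]))
  have hd : d * b + bᶜ = d := mul_add_compl_of_le (compl_le_iff.2 hbd)
  calc a * b + d = a * b + (d * b + bᶜ) := by rw [hd]
    _ = a * b + bᶜ + b * d := by rw [mul_comm d b, add_comm (b * d), add_assoc]
    _ = a + b * d := by rw [ha]

theorem add_mul_eq_add_mul {a b d : C} (hab : a + b ≠ 1) (hbd : b + d = 1) :
    (a + b) * d = a + b * d := by
  have hb : b * d + dᶜ = b := mul_add_compl_of_le (compl_le_iff.2 (by rwa [add_comm]))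
  have h1 : a + b * d + dᶜ ≠ 1 := by rwa [add_assoc, hb]
  have := add_mul_compl_of_le (le_compl_iff.2 (mul_eq_zero_of_add_ne_one h1))
  rwa [MVAlgebra.compl_compl, add_assoc, hb] at this

theorem add_ne_one_of_mul {a b d : C} (hab : a + b ≠ 1) (hbd : b + d = 1) :
    a + b * d ≠ 1 := fun h => hab (by
  rw [← add_mul_eq_add_mul hab hbd] at h
  exact one_le_iff.1 (h ▸ mul_le_left' _ _))

theorem mul_ne_one {a b : C} (h : a ≠ 1) : a * b ≠ 1 := fun h' =>
  h (one_le_iff.1 (h' ▸ mul_le_left' _ _))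

/-! ### The ordered group of an MV-chain -/

variable (C) in
/-- Chang's group of an MV-chain: the pair of `k` and `a ≠ 1` stands for `k` units plus `a`. -/
@[ext] structure Chang where
  int : ℤ
  frac : C
  frac_ne : frac ≠ 1

namespace Chang

-- When the fractional parts add up to `1`, one unit is carried and the remainder, their sum minus
-- one unit, is their product.
open Classical in
noncomputable instance : Add (Chang C) where
  add x y :=
    if h : x.frac + y.frac = 1 then ⟨x.int + y.int + 1, x.frac * y.frac, mul_ne_one x.frac_ne⟩
    else ⟨x.int + y.int, x.frac + y.frac, h⟩

theorem add_of_eq {x y : Chang C} (h : x.frac + y.frac = 1) :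
    x + y = ⟨x.int + y.int + 1, x.frac * y.frac, mul_ne_one x.frac_ne⟩ := dif_pos h

theorem add_of_ne {x y : Chang C} (h : x.frac + y.frac ≠ 1) :
    x + y = ⟨x.int + y.int, x.frac + y.frac, h⟩ := dif_neg h

theorem add_comm' (x y : Chang C) : x + y = y + x := by
  by_cases h : x.frac + y.frac = 1
  · rw [add_of_eq h, add_of_eq (by rwa [add_comm])]
    ext
    · simp only [add_comm]
    · exact mul_comm _ _
  · rw [add_of_ne h, add_of_ne (by rwa [add_comm])]
    ext
    · exact add_comm _ _
    · exact add_comm _ _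

theorem add_assoc_of_ne_of_eq {x y z : Chang C} (h : x.frac + y.frac ≠ 1)
    (h' : y.frac + z.frac = 1) : x + y + z = x + (y + z) := by
  have h1 : x.frac + y.frac + z.frac = 1 := by rw [add_assoc, h', add_one]
  have h2 := add_ne_one_of_mul h h'
  rw [add_of_ne h, add_of_eq h', add_of_eq (by exact h1), add_of_ne (by exact h2)]
  ext
  · simp only
    ring
  · exact add_mul_eq_add_mul h h'

theorem add_assoc' (x y z : Chang C) : x + y + z = x + (y + z) := by
  by_cases h : x.frac + y.frac = 1 <;> by_cases h' : y.frac + z.frac = 1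
  · have h3 := mul_add_eq_add_mul h h'
    rw [add_of_eq h, add_of_eq h']
    by_cases h2 : x.frac + y.frac * z.frac = 1
    · rw [add_of_eq (by exact h3.trans h2), add_of_eq (by exact h2)]
      ext
      · simp only
        ring
      · exact mul_assoc _ _ _
    · rw [add_of_ne (by simpa only [h3] using h2), add_of_ne (by exact h2)]
      ext
      · simp only
        ring
      · exact h3
  -- The other mixed case is the mirror image, reached by commutativity.
  · have := add_assoc_of_ne_of_eq (x := z) (y := y) (z := x) (by rwa [add_comm]) (by rwa [add_comm])
    rw [add_comm' x, add_comm' _ z, add_comm' x, add_comm' y z, ← this]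
  · exact add_assoc_of_ne_of_eq h h'
  · have h3 := add_mul_eq_mul_add h h'
    rw [add_of_ne h, add_of_ne h']
    by_cases h2 : x.frac + (y.frac + z.frac) = 1
    · rw [add_of_eq (by simpa only [add_assoc] using h2), add_of_eq (by exact h2)]
      ext
      · simp only
        ring
      · exact h3
    · rw [add_of_ne (by simpa only [add_assoc] using h2), add_of_ne (by exact h2)]
      ext
      · exact add_assoc _ _ _
      · exact add_assoc _ _ _

theorem int_add_le (x y : Chang C) : x.int + y.int ≤ (x + y).int := by
  by_cases h : x.frac + y.frac = 1
  · rw [add_of_eq h]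
    exact (Int.lt_add_one_iff.2 le_rfl).le
  · rw [add_of_ne h]

variable [NeZero (1 : C)]

theorem zero_ne_one' : (0 : C) ≠ 1 := NeZero.out.symm

instance : Zero (Chang C) := ⟨⟨0, 0, zero_ne_one'⟩⟩

theorem zero_int : (0 : Chang C).int = 0 := rfl

theorem zero_frac : (0 : Chang C).frac = 0 := rfl

theorem add_zero' (x : Chang C) : x + 0 = x := by
  have h : x.frac + (0 : Chang C).frac ≠ 1 := by
    rw [zero_frac, add_zero]
    exact x.frac_ne
  rw [add_of_ne h]
  ext
  · exact add_zero _
  · exact add_zero _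

open Classical in
noncomputable instance : Neg (Chang C) where
  neg x := if h : x.frac = 0 then ⟨-x.int, 0, zero_ne_one'⟩
    else ⟨-x.int - 1, x.fracᶜ, fun h' => h (by rw [← MVAlgebra.compl_compl x.frac, h', compl_one])⟩

theorem neg_of_eq {x : Chang C} (h : x.frac = 0) : -x = ⟨-x.int, 0, zero_ne_one'⟩ := dif_pos h

theorem neg_of_ne {x : Chang C} (h : x.frac ≠ 0) : -x = ⟨-x.int - 1, x.fracᶜ,
    fun h' => h (by rw [← MVAlgebra.compl_compl x.frac, h', compl_one])⟩ := dif_neg h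

theorem neg_add_self (x : Chang C) : -x + x = 0 := by
  by_cases h : x.frac = 0
  · rw [neg_of_eq h, add_of_ne (by simpa only [zero_add] using x.frac_ne)]
    ext
    · exact neg_add_cancel _
    · exact (zero_add _).trans h
  · rw [neg_of_ne h, add_of_eq (by exact compl_add_self _)]
    ext
    · simp only [zero_int]
      ring
    · exact (mul_comm _ _).trans (mul_compl_self _)

noncomputable instance : AddCommGroup (Chang C) where
  add_assoc := add_assoc'
  zero_add x := by rw [add_comm', add_zero']
  add_zero := add_zero'
  nsmul := nsmulRec
  zsmul := zsmulRec
  neg_add_cancel := neg_add_self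
  add_comm := add_comm'

variable (C) in
/-- The positive cone of Chang's group. -/
noncomputable def cone : AddGroupCone (Chang C) where
  carrier := {x | 0 ≤ x.int}
  add_mem' {x y} hx hy := (add_nonneg hx hy).trans (int_add_le x y)
  zero_mem' := zero_int.ge
  eq_zero_of_mem_of_neg_mem' {x} hx hx' := by
    change 0 ≤ x.int at hx
    change 0 ≤ (-x).int at hx'
    by_cases h : x.frac = 0
    · rw [neg_of_eq h] at hx'
      ext
      · simp only [zero_int] at hx' ⊢
        omega
      · exact h
    -- A nonzero fraction borrows one unit, so the integer parts of `x` and `-x` add up to `-1` and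
    -- cannot both be nonnegative.
    · rw [neg_of_ne h] at hx'
      simp only at hx'
      omega

theorem mem_cone {x : Chang C} : x ∈ cone C ↔ 0 ≤ x.int := Iff.rfl

instance : HasMemOrNegMem (cone C) where
  mem_or_neg_mem x := by
    rw [mem_cone, mem_cone]
    by_cases h : x.frac = 0
    · rw [neg_of_eq h]
      simp only
      omega
    · rw [neg_of_ne h]
      simp only
      omega

open Classical in
noncomputable instance : LinearOrder (Chang C) := LinearOrder.mkOfAddGroupCone (cone C)

instance : IsOrderedAddMonoid (Chang C) := IsOrderedAddMonoid.mkOfCone (cone C)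

theorem nonneg_iff {x : Chang C} : 0 ≤ x ↔ 0 ≤ x.int := by
  change x - 0 ∈ cone C ↔ _
  rw [sub_zero, mem_cone]

open Classical in
/-- The inclusion of an MV-chain in its group. -/
noncomputable def incl (a : C) : Chang C :=
  if h : a = 1 then ⟨1, 0, zero_ne_one'⟩ else ⟨0, a, h⟩

theorem incl_one : incl (1 : C) = ⟨1, 0, zero_ne_one'⟩ := dif_pos rfl

theorem incl_of_ne {a : C} (h : a ≠ 1) : incl a = ⟨0, a, h⟩ := dif_neg h

theorem incl_zero : incl (0 : C) = 0 := incl_of_ne zero_ne_one'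

theorem incl_nonneg (a : C) : 0 ≤ incl a := by
  rw [nonneg_iff]
  by_cases h : a = 1
  · rw [h, incl_one]
    exact zero_le_one
  · rw [incl_of_ne h]

theorem eq_zero_of_incl_eq_zero {a : C} (h : incl a = 0) : a = 0 := by
  by_cases h' : a = 1
  · rw [h', incl_one] at h
    exact absurd (congrArg int h) one_ne_zero
  · rw [incl_of_ne h'] at h
    exact congrArg frac h

theorem incl_add_of_eq {a b : C} (h : a + b = 1) : incl a + incl b = incl 1 + incl (a * b) := by
  by_cases ha : a = 1
  · rw [ha, one_mul]
  by_cases hb : b = 1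
  · rw [hb, mul_one, add_comm]
  rw [incl_of_ne ha, incl_of_ne hb, incl_one, incl_of_ne (mul_ne_one ha), add_of_eq (by exact h),
    add_of_ne (by simpa only [zero_add] using mul_ne_one ha)]
  ext
  · simp
  · exact (zero_add _).symm

/-- The condition `a * b = 0` says that `a + b` is not truncated, so it is the genuine sum in the
group. -/
theorem incl_add {a b : C} (h : a * b = 0) : incl (a + b) = incl a + incl b := by
  by_cases h' : a + b = 1
  · rw [incl_add_of_eq h', h, incl_zero, add_zero, h']
  · have ha : a ≠ 1 := by
      rintro rfl
      exact h' (one_add _)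
    have hb : b ≠ 1 := by
      rintro rfl
      exact h' (add_one _)
    rw [incl_of_ne h', incl_of_ne ha, incl_of_ne hb, add_of_ne (by exact h')]
    rfl

theorem incl_compl (a : C) : incl aᶜ = incl 1 - incl a := by
  rw [eq_sub_iff_add_eq, ← incl_add, compl_add_self]
  rw [mul_comm, mul_compl_self]

theorem incl_lt {a b : C} (h : a < b) : incl a < incl b := by
  have hb := eq_add_of_le h.le
  have hab : a * (bᶜ + a)ᶜ = 0 := by
    rw [← le_compl_iff, MVAlgebra.compl_compl]
    exact le_add_left' _ _
  rw [hb, incl_add hab]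
  refine lt_add_of_pos_right _ ((incl_nonneg _).lt_of_ne fun h0 => h.ne ?_)
  rw [hb, eq_zero_of_incl_eq_zero h0.symm, add_zero]

end Chang

end MVChain

/-! ### Embeddings of chains and the induced maps of Chang's groups. -/

namespace MVChain

open MVAlgebra

/-- An embedding of MV-algebras. -/
structure Embedding (B C : Type u) [MVAlgebra B] [MVAlgebra C] where
  toFun : B → C
  injective : Function.Injective toFun
  map_zero : toFun 0 = 0
  map_add : ∀ x y, toFun (x + y) = toFun x + toFun y
  map_compl : ∀ x, toFun xᶜ = (toFun x)ᶜ

namespace Embedding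

variable {B C : Type u} [MVChain B] [MVChain C] (j : Embedding B C)

theorem map_one : j.toFun 1 = 1 := by
  rw [one_def, j.map_compl, j.map_zero, compl_zero]

theorem map_mul (x y : B) : j.toFun (x * y) = j.toFun x * j.toFun y := by
  rw [mul_def, mul_def, j.map_compl, j.map_add, j.map_compl, j.map_compl]

theorem map_eq_one {x : B} : j.toFun x = 1 ↔ x = 1 :=
  ⟨fun h => j.injective (h.trans j.map_one.symm), fun h => h ▸ j.map_one⟩

variable [NeZero (1 : B)] [NeZero (1 : C)]

/-- The homomorphism of Chang's groups induced by an embedding. -/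
noncomputable def changMap : Chang B →+ Chang C where
  toFun x := ⟨x.int, j.toFun x.frac, fun h => x.frac_ne (j.map_eq_one.1 h)⟩
  map_zero' := by
    ext
    · rfl
    · exact j.map_zero
  map_add' x y := by
    by_cases h : x.frac + y.frac = 1
    · rw [Chang.add_of_eq h, Chang.add_of_eq (by rw [← j.map_add, h, j.map_one])]
      ext
      · rfl
      · exact j.map_mul _ _
    · rw [Chang.add_of_ne h, Chang.add_of_ne (by rwa [← j.map_add, ne_eq, j.map_eq_one])]
      ext
      · rfl
      · exact j.map_add _ _

theorem changMap_strictMono : StrictMono j.changMap := by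
  refine Monotone.strictMono_of_injective ?_ ?_
  · rw [monotone_iff_map_nonneg]
    intro x hx
    rw [Chang.nonneg_iff] at hx ⊢
    exact hx
  · intro x y h
    ext
    · have h' : (j.changMap x).int = (j.changMap y).int := congrArg Chang.int h
      exact h'
    · have h' : (j.changMap x).frac = (j.changMap y).frac := congrArg Chang.frac h
      exact j.injective h'

theorem changMap_incl (b : B) : j.changMap (Chang.incl b) = Chang.incl (j.toFun b) := by
  by_cases h : b = 1
  · rw [h, j.map_one, Chang.incl_one, Chang.incl_one]
    ext
    · rfl
    · exact j.map_zero
  · rw [Chang.incl_of_ne h, Chang.incl_of_ne (by rwa [ne_eq, j.map_eq_one])]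
    rfl

end Embedding

end MVChain

/-! ### Ordered rational vector spaces -/

namespace DivisibleHull

variable {M N : Type*} [AddCommGroup M] [LinearOrder M] [IsOrderedAddMonoid M]
  [AddCommGroup N] [LinearOrder N] [IsOrderedAddMonoid N]

/-- The linear map of divisible hulls induced by a homomorphism of groups. -/
noncomputable def mapLinear (j : M →+ N) : DivisibleHull M →ₗ[ℚ] DivisibleHull N :=
  AddMonoidHom.toRatLinearMap
    { toFun := fun x => x.liftOn (fun m s => mk (j m) s) (by
        intro m m' s s' h
        rw [mk_eq_mk_iff_smul_eq_smul] at h ⊢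
        rw [← map_nsmul, ← map_nsmul, h])
      map_zero' := by
        rw [← mk_zero 1, liftOn_mk, map_zero, mk_zero]
      map_add' := fun x y => by
        induction x with | mk m s
        induction y with | mk m' s'
        rw [mk_add_mk, liftOn_mk, liftOn_mk, liftOn_mk, mk_add_mk, map_add, map_nsmul, map_nsmul] }

theorem mapLinear_mk (j : M →+ N) (m : M) (s : ℕ+) : mapLinear j (mk m s) = mk (j m) s := rfl

theorem mapLinear_strictMono {j : M →+ N} (hj : StrictMono j) : StrictMono (mapLinear j) := by
  intro x y h
  induction x with | mk m s
  induction y with | mk m' s'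
  rw [mapLinear_mk, mapLinear_mk]
  rw [mk_lt_mk] at h ⊢
  rw [← map_nsmul, ← map_nsmul]
  exact hj h

end DivisibleHull

/-- Finitely many vectors of a salient convex cone have positive values under some functional. -/
theorem exists_linearMap_pos {W : Type*} [AddCommGroup W] [Module ℚ W] (K : W → Prop)
    (hadd : ∀ x y, K x → K y → K (x + y)) (hsmul : ∀ (c : ℚ) x, 0 < c → K x → K (c • x))
    (h0 : ¬ K 0) {ι : Type*} (s : Finset ι) :
    ∀ p : ι → W, (∀ i ∈ s, K (p i)) → ∃ f : W →ₗ[ℚ] ℚ, ∀ i ∈ s, 0 < f (p i) := by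
  classical
  induction s using Finset.induction_on with
  | empty => exact fun p _ => ⟨0, by simp⟩
  | insert a s ha ih =>
    intro p hp
    have hpa : K (p a) := hp a (Finset.mem_insert_self _ _)
    have hps : ∀ i ∈ s, K (p i) := fun i hi => hp i (Finset.mem_insert_of_mem hi)
    obtain ⟨f, hf⟩ := ih p hps
    -- Finitely many positive numbers survive a small perturbation; this absorbs the error terms in
    -- the cases below.
    have small : ∀ (r q : ι → ℚ), (∀ i ∈ s, 0 < r i) → ∃ ε : ℚ, 0 < ε ∧
        ∀ i ∈ s, 0 < r i + ε * q i := by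
      intro r q hr
      clear ih hf hps hp ha
      induction s using Finset.induction_on with
      | empty => exact ⟨1, one_pos, by simp⟩
      | insert b t hb iht =>
        obtain ⟨ε, hε, h⟩ := iht fun i hi => hr i (Finset.mem_insert_of_mem hi)
        have hrb := hr b (Finset.mem_insert_self _ _)
        have hq : 0 < 1 + |q b| := by positivity
        -- On `t`, positivity at `0` and at `ε` gives positivity in between; the last bound handles
        -- the index `b`.
        have aux : ∀ δ : ℚ, 0 < δ → δ ≤ ε → δ * (1 + |q b|) ≤ r b →
            ∀ i ∈ insert b t, 0 < r i + δ * q i := by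
          intro δ hδ hδε hδb i hi
          rcases Finset.mem_insert.1 hi with rfl | hi'
          · have := neg_abs_le (q i)
            nlinarith
          · have h1 := h i hi'
            have h2 := hr i hi
            rcases le_total 0 (q i) with h3 | h3
            · positivity
            · nlinarith
        refine ⟨min ε (r b / (1 + |q b|)), lt_min hε (by positivity), ?_⟩
        refine aux _ (lt_min hε (by positivity)) (min_le_left _ _) ?_
        rw [← le_div_iff₀ hq]
        exact min_le_right _ _
    rcases lt_trichotomy (f (p a)) 0 with hneg | hzero | hpos
    -- The `c i` are chosen so that `p i + c i • p a` lies in the kernel of `f`; a multiple of `f`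
    -- can then adjust the value at `p a` without disturbing these vectors.
    · let c : ι → ℚ := fun i => - f (p i) / f (p a)
      have hc : ∀ i ∈ s, 0 < c i := fun i hi =>
        div_pos_of_neg_of_neg (neg_neg_of_pos (hf i hi)) hneg
      obtain ⟨g, hg⟩ := ih (fun i => p i + c i • p a) fun i hi =>
        hadd _ _ (hps i hi) (hsmul _ _ (hc i hi) hpa)
      obtain ⟨ε, hε, h⟩ := small (fun i => g (p i + c i • p a)) (fun i => - c i) hg
      -- This functional takes the value `ε` at `p a` and `g (p i + c i • p a) - ε * c i` at `p i`.
      refine ⟨g + ((ε - g (p a)) / f (p a)) • f, fun i hi => ?_⟩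
      have hne := hneg.ne
      rcases Finset.mem_insert.1 hi with rfl | hi
      · simp only [LinearMap.add_apply, LinearMap.smul_apply, smul_eq_mul]
        rw [div_mul_cancel₀ _ hne]
        simpa using hε
      · have := h i hi
        simp only [map_add, map_smul, smul_eq_mul, c] at this
        simp only [LinearMap.add_apply, LinearMap.smul_apply, smul_eq_mul]
        convert this using 1
        field_simp
        ring
    -- Here `f` is perturbed by a small multiple of a functional with value `1` at `p a`.
    · have hne : p a ≠ 0 := fun h => h0 (h ▸ hpa)
      obtain ⟨g, hg⟩ : ∃ g : Module.Dual ℚ W, g (p a) ≠ 0 := by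
        by_contra! h
        exact hne ((Module.forall_dual_apply_eq_zero_iff ℚ _).1 h)
      obtain ⟨ε, hε, h⟩ := small (fun i => f (p i)) (fun i => (g (p a))⁻¹ * g (p i)) hf
      refine ⟨f + (ε * (g (p a))⁻¹) • g, fun i hi => ?_⟩
      rcases Finset.mem_insert.1 hi with rfl | hi
      · simp only [LinearMap.add_apply, LinearMap.smul_apply, smul_eq_mul, hzero, zero_add]
        rwa [mul_assoc, inv_mul_cancel₀ hg, mul_one]
      · simpa [mul_assoc] using h i hi
    · refine ⟨f, fun i hi => ?_⟩
      rcases Finset.mem_insert.1 hi with rfl | hi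
      · exact hpos
      · exact hf i hi

/-- Totally ordered vector spaces over a common subspace admit functionals which agree on the
subspace and are positive on finitely many given positive vectors. -/
theorem exists_compatible_linearMap {ι : Type*} [Fintype ι] {E : Type*} {D : ι → Type*}
    [AddCommGroup E] [Module ℚ E] [LinearOrder E] [IsOrderedAddMonoid E]
    [∀ i, AddCommGroup (D i)] [∀ i, Module ℚ (D i)] [∀ i, LinearOrder (D i)]
    [∀ i, IsOrderedAddMonoid (D i)] [∀ i, PosSMulStrictMono ℚ (D i)]
    (j : ∀ i, E →ₗ[ℚ] D i) (hj : ∀ i, StrictMono (j i)) (S : ∀ i, Finset (D i)) :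
    ∃ f : ∀ i, D i →ₗ[ℚ] ℚ, (∀ i k e, f i (j i e) = f k (j k e)) ∧
      ∀ i, ∀ x ∈ S i, 0 < x → 0 < f i x := by
  classical
  -- The quotient by `R` is the sum of the `D i` in which all copies of `E` are identified. A
  -- nonnegative element of `R` has nonnegative coefficients with sum `0`, so it vanishes; hence the
  -- image of the positive cone is salient.
  let R : Submodule ℚ (∀ i, D i) :=
    (LinearMap.ker (∑ i, LinearMap.proj i : (ι → E) →ₗ[ℚ] E)).map
      (LinearMap.pi fun i => (j i).comp (LinearMap.proj i))
  have hR : ∀ x ∈ R, 0 ≤ x → x = 0 := by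
    rintro _ ⟨c, hc, rfl⟩ hx
    have hc' : ∑ i, c i = 0 := by simpa using hc
    have hnn : ∀ i, 0 ≤ c i := fun i => (hj i).le_iff_le.1 (by
      rw [map_zero]
      exact hx i)
    have := (Finset.sum_eq_zero_iff_of_nonneg fun i _ => hnn i).1 hc'
    ext i
    simp [this i (Finset.mem_univ i)]
  obtain ⟨f, hf⟩ := exists_linearMap_pos (W := (∀ i, D i) ⧸ R)
    (fun w => ∃ x : ∀ i, D i, 0 ≤ x ∧ x ≠ 0 ∧ R.mkQ x = w)
    (by
      rintro _ _ ⟨x, hx, hx0, rfl⟩ ⟨y, hy, hy0, rfl⟩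
      refine ⟨x + y, add_nonneg hx hy, fun h => hx0 ?_, map_add _ _ _⟩
      exact le_antisymm ((le_add_of_nonneg_right hy).trans h.le) hx)
    (by
      rintro c _ hc ⟨x, hx, hx0, rfl⟩
      refine ⟨c • x, fun i => ?_, fun h => hx0 ?_, map_smul _ _ _⟩
      · rw [Pi.smul_apply, Pi.zero_apply, ← smul_zero c]
        exact smul_le_smul_of_nonneg_left (hx i) hc.le
      · exact (smul_eq_zero.1 h).resolve_left hc.ne')
    (by
      rintro ⟨x, hx, hx0, h⟩
      exact hx0 (hR x ((Submodule.Quotient.mk_eq_zero R).1 h) hx))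
    (Finset.univ.sigma fun i => (S i).filter (0 < ·))
    (fun p => R.mkQ (Pi.single p.1 p.2))
    (by
      rintro ⟨i, x⟩ hx
      simp only [Finset.mem_sigma, Finset.mem_univ, Finset.mem_filter, true_and] at hx
      exact ⟨_, Pi.single_nonneg.2 hx.2.le, by simpa using hx.2.ne', rfl⟩)
  refine ⟨fun i => f.comp (R.mkQ.comp (LinearMap.single ℚ D i)), fun i k e => ?_,
    fun i x hx h0 => hf ⟨i, x⟩ (by simp [hx, h0])⟩
  simp only [LinearMap.comp_apply]
  congr 1
  refine (Submodule.Quotient.eq R).2 ⟨Pi.single i e - Pi.single k e, ?_, ?_⟩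
  · simp
  · ext l
    simp only [LinearMap.pi_apply, LinearMap.comp_apply, LinearMap.proj_apply, Pi.sub_apply,
      map_sub, LinearMap.single_apply]
    congr 1
    · by_cases h : l = i
      · subst h
        simp
      · simp [h]
    · by_cases h : l = k
      · subst h
        simp
      · simp [h]

/-! ### Rational approximation of chains over a common subchain. -/

namespace MVChain

open MVAlgebra

/-- Finitely many elements of MV-chains over a common subchain have rational approximations. -/
theorem exists_rational_approx {ι : Type*} [Fintype ι] [Nonempty ι] {B : Type u} {C : ι → Type u}
    [MVChain B] [∀ i, MVChain (C i)] [NeZero (1 : B)] [∀ i, NeZero (1 : C i)]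
    (j : ∀ i, Embedding B (C i)) (S : ∀ i, Finset (C i)) :
    ∃ g : ∀ i, C i → ℚ, (∀ i, g i 0 = 0) ∧ (∀ i x, g i xᶜ = 1 - g i x) ∧
      (∀ i, ∀ x ∈ S i, ∀ y ∈ S i, g i (x + y) = min (g i x + g i y) 1) ∧
      (∀ i, ∀ x ∈ S i, ∀ y ∈ S i, x < y → g i x < g i y) ∧
      (∀ i, ∀ x ∈ S i, 0 ≤ g i x ∧ g i x ≤ 1) ∧
      ∀ i k b, g i ((j i).toFun b) = g k ((j k).toFun b) := by
  classical
  let v : ∀ i, C i → DivisibleHull (Chang (C i)) := fun i x =>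
    DivisibleHull.coeOrderAddMonoidHom _ (Chang.incl x)
  -- Complements are included because comparing `x` with `yᶜ` decides whether `x + y` is truncated;
  -- `0` and `1` make the normalizing constant positive and bound the values.
  let T : ∀ i, Finset (C i) := fun i => insert 0 (insert 1 (S i ∪ (S i).image (·ᶜ)))
  obtain ⟨f, hf, hpos⟩ := exists_compatible_linearMap
    (fun i => DivisibleHull.mapLinear (j i).changMap)
    (fun i => DivisibleHull.mapLinear_strictMono (j i).changMap_strictMono)
    (fun i => (T i ×ˢ T i).image fun p => v i p.2 - v i p.1)
  have hcompat : ∀ i k b, f i (v i ((j i).toFun b)) = f k (v k ((j k).toFun b)) := by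
    intro i k b
    have h : ∀ i, DivisibleHull.mapLinear (j i).changMap (DivisibleHull.mk (Chang.incl b) 1) =
        v i ((j i).toFun b) := fun i => by
      rw [DivisibleHull.mapLinear_mk, Embedding.changMap_incl]
      rfl
    rw [← h, ← h]
    exact hf i k _
  have hmono : ∀ i, StrictMono (DivisibleHull.coeOrderAddMonoidHom (Chang (C i))) := fun i =>
    (OrderHomClass.mono _).strictMono_of_injective DivisibleHull.coe_injective
  have hlt : ∀ i, ∀ x ∈ T i, ∀ y ∈ T i, x < y → f i (v i x) < f i (v i y) := by
    intro i x hx y hy h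
    rw [← sub_pos, ← map_sub]
    refine hpos i _ (Finset.mem_image.2 ⟨(x, y), ?_, rfl⟩) ?_
    · exact Finset.mem_product.2 ⟨hx, hy⟩
    · exact sub_pos.2 (hmono i (Chang.incl_lt h))
  have h0T : ∀ i, 0 ∈ T i := fun i => Finset.mem_insert_self _ _
  have h1T : ∀ i, 1 ∈ T i := fun i => Finset.mem_insert_of_mem (Finset.mem_insert_self _ _)
  have hST : ∀ i, ∀ x ∈ S i, x ∈ T i := fun i x hx =>
    Finset.mem_insert_of_mem (Finset.mem_insert_of_mem (Finset.mem_union_left _ hx))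
  have hST' : ∀ i, ∀ x ∈ S i, xᶜ ∈ T i := fun i x hx =>
    Finset.mem_insert_of_mem (Finset.mem_insert_of_mem
      (Finset.mem_union_right _ (Finset.mem_image_of_mem _ hx)))
  have hv0 : ∀ i, v i 0 = 0 := fun i => by simp only [v, Chang.incl_zero, map_zero]
  have hle : ∀ i, ∀ x ∈ T i, ∀ y ∈ T i, x ≤ y → f i (v i x) ≤ f i (v i y) := by
    intro i x hx y hy h
    rcases h.eq_or_lt with rfl | h
    · exact le_rfl
    · exact (hlt i x hx y hy h).le
  let i₀ : ι := Classical.arbitrary ι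
  -- The unit comes from `B`, so every functional has the same value on it; dividing by that value
  -- sends `1` to `1`.
  let c : ℚ := f i₀ (v i₀ 1)
  have hc : ∀ i, f i (v i 1) = c := fun i => by
    have := hcompat i i₀ 1
    rwa [Embedding.map_one, Embedding.map_one] at this
  have hcpos : 0 < c := by
    have := hlt i₀ 0 (h0T _) 1 (h1T _) ((zero_le' _).lt_of_ne Chang.zero_ne_one')
    rwa [hv0, map_zero] at this
  have hcompl : ∀ i (x : C i), f i (v i xᶜ) = c - f i (v i x) := fun i x => by
    simp only [v, Chang.incl_compl, map_sub]
    rw [hc i]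
  refine ⟨fun i x => f i (v i x) / c, fun i => ?_, fun i x => ?_, fun i x hx y hy => ?_,
    fun i x hx y hy h => ?_, fun i x hx => ⟨?_, ?_⟩, fun i k b => ?_⟩
  · simp only [hv0, map_zero, zero_div]
  · simp only
    rw [hcompl, sub_div, div_self hcpos.ne']
  · simp only
    rw [← add_div]
    by_cases h : x + y = 1
    · have := hle i yᶜ (hST' i y hy) x (hST i x hx) (compl_le_iff.2 (by rwa [add_comm]))
      rw [hcompl] at this
      rw [h, hc i, div_self hcpos.ne', min_eq_right]
      rw [one_le_div hcpos]
      linarith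
    · have hxy := mul_eq_zero_of_add_ne_one h
      have := hle i x (hST i x hx) yᶜ (hST' i y hy) (le_compl_iff.2 hxy)
      rw [hcompl] at this
      have hsum : v i (x + y) = v i x + v i y := by
        simp only [v]
        rw [← map_add, Chang.incl_add hxy]
      rw [hsum, map_add, min_eq_left]
      rw [div_le_one hcpos]
      linarith
  · exact div_lt_div_of_pos_right (hlt i x (hST i x hx) y (hST i y hy) h) hcpos
  · have := hle i 0 (h0T i) x (hST i x hx) (zero_le' _)
    rw [hv0, map_zero] at this
    exact div_nonneg this hcpos.le
  · rw [div_le_one hcpos, ← hc i]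
    exact hle i x (hST i x hx) 1 (h1T i) (le_one' _)
  · simp only
    rw [hcompat i k b]

end MVChain

/-! ### Monadic MV-algebras and witnessing prime filters. -/

/-- A monadic MV-algebra. -/
class MonadicMVAlgebra (A : Type u) extends MVAlgebra A where
  ex : A → A
  all : A → A
  all_imp_self : ∀ x : A, (all x)ᶜ + x = 1
  all_imp_all : ∀ x y : A, all (xᶜ + all y) = (ex x)ᶜ + all y
  all_all_imp : ∀ x y : A, all ((all x)ᶜ + y) = (all x)ᶜ + all y
  all_ex_sup : ∀ x y : A, all (ex x ⊔ y) = ex x ⊔ all y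
  ex_mul_self : ∀ x : A, ex (x * x) = ex x * ex x

namespace MonadicMVAlgebra

open MVAlgebra

variable {A : Type u} [MonadicMVAlgebra A]

theorem all_le (x : A) : all x ≤ x := le_iff.2 (all_imp_self x)

theorem all_zero : all (0 : A) = 0 := le_antisymm (all_le 0) (zero_le' _)

theorem all_ex (x : A) : all (ex x) = ex x := by
  refine le_antisymm (all_le _) ?_
  have := all_ex_sup x (ex x)
  rw [sup_idem] at this
  rw [this]
  exact le_sup_left

theorem le_ex (x : A) : x ≤ ex x := by
  have := all_imp_all x (ex x)
  rw [all_ex, compl_add_self] at this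
  exact le_iff.2 (one_le_iff.1 (this ▸ all_le _))

theorem all_one : all (1 : A) = 1 := by
  have := all_all_imp (1 : A) 1
  rwa [add_one, compl_add_self] at this

theorem ex_all (x : A) : ex (all x) = all x := by
  refine le_antisymm ?_ (le_ex _)
  have := all_imp_all (all x) x
  rw [compl_add_self, all_one] at this
  exact le_iff.2 this.symm

theorem all_all (x : A) : all (all x) = all x := by
  have := all_ex (all x)
  rwa [ex_all] at this

theorem all_mono {x y : A} (h : x ≤ y) : all x ≤ all y := by
  have := all_all_imp x y
  rw [le_iff.1 ((all_le x).trans h), all_one] at this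
  exact le_iff.2 this.symm

theorem all_compl (x : A) : all xᶜ = (ex x)ᶜ := by
  have := all_imp_all x 0
  rwa [all_zero, add_zero, add_zero] at this

theorem ex_mono {x y : A} (h : x ≤ y) : ex x ≤ ex y := by
  have := compl_le_compl (all_mono (compl_le_compl h))
  rwa [all_compl, all_compl, MVAlgebra.compl_compl, MVAlgebra.compl_compl] at this

theorem ex_compl (x : A) : ex xᶜ = (all x)ᶜ := by
  rw [← MVAlgebra.compl_compl (ex xᶜ), ← all_compl, MVAlgebra.compl_compl]

theorem all_compl_of_fixed {x : A} (hx : all x = x) : all xᶜ = xᶜ := by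
  have := all_all_imp x 0
  rwa [all_zero, add_zero, hx] at this

theorem all_add_of_fixed {x y : A} (hx : all x = x) (hy : all y = y) : all (x + y) = x + y := by
  have := all_all_imp xᶜ y
  rwa [all_compl_of_fixed hx, MVAlgebra.compl_compl, hy] at this

theorem ex_of_fixed {x : A} (hx : all x = x) : ex x = x := by
  rw [← hx, ex_all]

theorem all_sup_of_fixed {x y : A} (hx : all x = x) (hy : all y = y) : all (x ⊔ y) = x ⊔ y := by
  have := all_ex_sup x y
  rwa [ex_of_fixed hx, hy] at this

/-- Dually, `∀(x ⊖ ∀x) = 0`: if `e` denotes this element, then `e + ∀x` is a fixed element below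
`x`, hence below `∀x`. As this sum is not truncated, `e = 0`. -/
theorem ex_imp_all (x : A) : ex (xᶜ + all x) = 1 := by
  suffices h : all (x * (all x)ᶜ) = 0 by
    have := ex_compl (x * (all x)ᶜ)
    rwa [compl_mul, h, MVAlgebra.compl_compl, MVAlgebra.compl_zero] at this
  set e := all (x * (all x)ᶜ) with he
  have h1 : e + all x ≤ x := by
    have h2 := mul_add_compl_of_le (x := x) (y := (all x)ᶜ)
      (by rw [MVAlgebra.compl_compl]; exact all_le x)
    rw [MVAlgebra.compl_compl] at h2
    calc e + all x ≤ x * (all x)ᶜ + all x := add_le_add_left (all_le _) _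
      _ = x := h2
  have h2 : e + all x ≤ all x := by
    have := all_mono h1
    rwa [all_add_of_fixed (all_all _) (all_all _)] at this
  have h3 : e ≤ (all x)ᶜ := (all_le _).trans (mul_le_right' _ _)
  rw [← add_mul_compl_of_le h3, le_antisymm h2 (le_add_left' _ _), mul_compl_self]

/-- The axiom on squares reaches only exponents `2 ^ k`, which suffices because powers decrease. -/
theorem ex_pow {w : A} (hw : ex w = 1) (k : ℕ) : ex (w ^ 2 ^ k) = 1 := by
  induction k with
  | zero => simpa using hw
  | succ k ih => rw [pow_succ, pow_mul, pow_two, ex_mul_self, ih, mul_one]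

/-- Adjoining an element `w` with `∃w = 1` to a filter generated by fixed elements forces no new
fixed elements. -/
theorem le_of_mul_pow_le {w p z : A} (hw : ex w = 1) (hp : all p = p) (hz : all z = z) (n : ℕ)
    (h : p * w ^ n ≤ z) : p ≤ z := by
  have h1 : w ^ 2 ^ n ≤ pᶜ + z := by
    refine (pow_le_pow_right_of_le_one' (le_one' w) Nat.lt_two_pow_self.le).trans ?_
    rwa [← mul_le_iff, mul_comm]
  have h2 := ex_mono h1
  rw [ex_pow hw, ex_of_fixed (all_add_of_fixed (all_compl_of_fixed hp) hz)] at h2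
  exact le_iff.2 (one_le_iff.1 h2)

/-- A prime filter containing `x → ∀ x`, with prescribed trace on the quantifier-free part. -/
theorem exists_isPrime_witness (Q₀ : Filt A) (hQ₀ : Q₀.IsPrime) (x : A) :
    ∃ Q : Filt A, Q.IsPrime ∧ xᶜ + all x ∈ Q.carrier ∧
      ∀ z, all z = z → (z ∈ Q.carrier ↔ z ∈ Q₀.carrier) := by
  set w := xᶜ + all x with hw
  -- `F` is generated by `w` and the fixed elements of `Q₀`. Separating it from the fixed elements
  -- outside `Q₀`, which are closed under joins because `Q₀` is prime, makes the trace exactly that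
  -- of `Q₀`.
  let F : Filt A :=
    { carrier := {z | ∃ p ∈ Q₀.carrier, all p = p ∧ ∃ n : ℕ, p * w ^ n ≤ z}
      one_mem := ⟨1, Q₀.one_mem, all_one, 0, le_one' _⟩
      mp := by
        rintro y z ⟨p, hp, hpa, n, hn⟩ ⟨q, hq, hqa, k, hk⟩
        refine ⟨p * q, Q₀.mul_mem hp hq, ?_, n + k, ?_⟩
        · exact all_compl_of_fixed
            (all_add_of_fixed (all_compl_of_fixed hpa) (all_compl_of_fixed hqa))
        · rw [pow_add, mul_mul_mul_comm]
          exact (mul_le_mul' hn hk).trans (mul_imp_le _ _) }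
  obtain ⟨Q, hFQ, hQI, hQ⟩ := F.exists_isPrime_disjoint {z | all z = z ∧ z ∉ Q₀.carrier}
    (by
      rintro y ⟨hy, hyQ⟩ z ⟨hz, hzQ⟩
      exact ⟨all_sup_of_fixed hy hz, fun h => (hQ₀ _ _ h).elim hyQ hzQ⟩)
    (by
      rw [Set.disjoint_left]
      rintro z ⟨p, hp, hpa, n, hn⟩ ⟨hz, hzQ⟩
      exact hzQ (Q₀.mem_of_le hp (le_of_mul_pow_le (ex_imp_all x) hpa hz n hn)))
  refine ⟨Q, hQ, hFQ ⟨1, Q₀.one_mem, all_one, 1, by simp⟩, fun z hz => ⟨fun h => ?_, fun h => ?_⟩⟩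
  · by_contra h'
    exact Set.disjoint_left.1 hQI h ⟨hz, h'⟩
  · exact hFQ ⟨z, h, hz, 0, by simp⟩

/-! ### The fixed subalgebra and its common quotient. -/

variable (A) in
/-- The subalgebra of all `x` with `∀ x = x`. -/
def Fixed : Type u := {x : A // all x = x}

instance : Zero (Fixed A) := ⟨⟨0, all_zero⟩⟩

instance : Add (Fixed A) := ⟨fun x y => ⟨x.1 + y.1, all_add_of_fixed x.2 y.2⟩⟩

instance : Compl (Fixed A) := ⟨fun x => ⟨x.1ᶜ, all_compl_of_fixed x.2⟩⟩

instance : MVAlgebra (Fixed A) where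
  nsmul := nsmulRec
  add_assoc x y z := Subtype.ext (add_assoc x.1 y.1 z.1)
  add_comm x y := Subtype.ext (add_comm x.1 y.1)
  zero_add x := Subtype.ext (zero_add x.1)
  add_zero x := Subtype.ext (add_zero x.1)
  compl_compl' x := Subtype.ext (compl_compl' x.1)
  add_compl_zero' x := Subtype.ext (add_compl_zero' x.1)
  lukasiewicz' x y := Subtype.ext (lukasiewicz' x.1 y.1)

/-- The trace of a filter on the fixed elements. -/
def trace (Q : Filt A) : Filt (Fixed A) where
  carrier := {x | x.1 ∈ Q.carrier}
  one_mem := Q.one_mem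
  mp hx hy := Q.mp hx hy

theorem trace_isPrime {Q : Filt A} (hQ : Q.IsPrime) : (trace Q).IsPrime :=
  fun x y h => hQ x.1 y.1 h

/-- The embedding of quotients induced by filters with the same trace. -/
def traceEmbedding (Q₀ Q : Filt A) (h : ∀ z, all z = z → (z ∈ Q.carrier ↔ z ∈ Q₀.carrier)) :
    MVChain.Embedding (trace Q₀).Quo Q.Quo where
  toFun := Quotient.map (fun x => x.1) fun x y hxy =>
    ⟨(h _ (xᶜ + y).2).2 hxy.1, (h _ (yᶜ + x).2).2 hxy.2⟩
  injective := by
    rintro ⟨x⟩ ⟨y⟩ hxy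
    have := Quotient.exact (s := Q.setoid) hxy
    exact Quotient.sound (s := (trace Q₀).setoid)
      ⟨(h _ (xᶜ + y).2).1 this.1, (h _ (yᶜ + x).2).1 this.2⟩
  map_zero := rfl
  map_add := by
    rintro ⟨x⟩ ⟨y⟩
    rfl
  map_compl := by
    rintro ⟨x⟩
    rfl

theorem quo_neZero {B : Type u} [MVAlgebra B] {F : Filt B} (h : 0 ∉ F.carrier) :
    NeZero (1 : F.Quo) := by
  refine ⟨fun h1 => h ?_⟩
  have : F.proj 1 ≤ F.proj 0 := le_of_eq h1
  rwa [Filt.proj_le_proj, MVAlgebra.compl_one, zero_add] at this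

/-! ### Rational approximation of monadic MV-algebras. -/

/-- Finite parts of monadic MV-algebras have approximations by tuples of rational numbers. -/
theorem exists_rational_approx (S : Finset A) {s t : A} (hs : s ∈ S) (ht : t ∈ S)
    (hst : s ≠ t) :
    ∃ n : ℕ, 1 ≤ n ∧ ∃ g : Fin n → A → ℚ, (∀ i, g i 0 = 0) ∧ (∀ i x, g i xᶜ = 1 - g i x) ∧
      (∀ i, ∀ x ∈ S, ∀ y ∈ S, g i (x + y) = min (g i x + g i y) 1) ∧
      (∀ i, ∀ x ∈ S, 0 ≤ g i x ∧ g i x ≤ 1) ∧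
      (∀ x ∈ S, ex x ∈ S →
        (∀ i, g i x ≤ g i (ex x)) ∧ (∃ i, g i x = g i (ex x)) ∧ ∀ i k, g i (ex x) = g k (ex x)) ∧
      (∀ x ∈ S, all x ∈ S →
        (∀ i, g i (all x) ≤ g i x) ∧ (∃ i, g i x = g i (all x)) ∧
          ∀ i k, g i (all x) = g k (all x)) ∧
      ∃ i, g i s ≠ g i t := by
  classical
  wlog hle : sᶜ + t ≠ 1 generalizing s t
  · have h2 : tᶜ + s ≠ 1 := fun h => hst (le_antisymm (le_iff.2 (not_not.1 hle)) (le_iff.2 h))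
    obtain ⟨n, hn, g, h⟩ := this ht hs hst.symm h2
    simp_rw [ne_comm (a := g _ t)] at h
    exact ⟨n, hn, g, h⟩
  -- Omitting `∀(s → t)`, and not merely `s → t`, records the failure on a fixed element, which
  -- every filter with the same trace sees.
  obtain ⟨Q₀, -, hQI, hQ₀⟩ := Filt.exists_isPrime_disjoint
    (⟨{1}, rfl, by
      rintro x y rfl h
      rwa [MVAlgebra.compl_one, zero_add] at h⟩ : Filt A) {all (sᶜ + t)}
    (by
      rintro x rfl y rfl
      exact sup_idem _)
    (by
      rw [Set.disjoint_singleton]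
      exact fun h => hle (one_le_iff.1 (h ▸ all_le _)))
  have hst₀ : all (sᶜ + t) ∉ Q₀.carrier := fun h => Set.disjoint_left.1 hQI h rfl
  -- `IsPrime` does not include properness, which is needed for `0 ≠ 1` in the quotients.
  have h0 : (0 : A) ∉ Q₀.carrier := fun h => hst₀ (Q₀.mem_of_le h (zero_le' _))
  choose Q hQ hQw hQ0 using exists_isPrime_witness Q₀ hQ₀
  -- Each element of `T` gives one coordinate: `x` attains `∀x` modulo `Q x`, it attains `∃x` modulo
  -- `Q xᶜ`, and `Q (sᶜ + t)` separates `s` from `t`.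
  let T : Finset A := insert (sᶜ + t) (S ∪ S.image (·ᶜ))
  let ι := {x // x ∈ T}
  have : Nonempty ι := ⟨⟨sᶜ + t, Finset.mem_insert_self _ _⟩⟩
  let : MVChain (trace Q₀).Quo := MVChain.ofPrime _ (trace_isPrime hQ₀)
  let : ∀ i : ι, MVChain (Q i.1).Quo := fun i => MVChain.ofPrime _ (hQ i.1)
  have : NeZero (1 : (trace Q₀).Quo) := quo_neZero h0
  have : ∀ i : ι, NeZero (1 : (Q i.1).Quo) := fun i =>
    quo_neZero fun h => h0 ((hQ0 i.1 0 all_zero).1 h)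
  obtain ⟨g, g0, gc, ga, glt, gb, gt⟩ := MVChain.exists_rational_approx
    (fun i : ι => traceEmbedding Q₀ (Q i.1) (hQ0 i.1)) fun i => S.image (Q i.1).proj
  have hmem : ∀ (i : ι) {x : A}, x ∈ S → (Q i.1).proj x ∈ S.image (Q i.1).proj :=
    fun i x hx => Finset.mem_image_of_mem _ hx
  have hmono : ∀ (i : ι), ∀ x ∈ S, ∀ y ∈ S, xᶜ + y ∈ (Q i.1).carrier →
      g i ((Q i.1).proj x) ≤ g i ((Q i.1).proj y) := by
    intro i x hx y hy h
    rcases ((Q i.1).proj_le_proj.2 h).eq_or_lt with h | h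
    · rw [h]
    · exact (glt i _ (hmem i hx) _ (hmem i hy) h).le
  have hmono' : ∀ (i : ι), ∀ x ∈ S, ∀ y ∈ S, x ≤ y →
      g i ((Q i.1).proj x) ≤ g i ((Q i.1).proj y) := fun i x hx y hy h =>
    hmono i x hx y hy (by rw [le_iff.1 h]; exact (Q i.1).one_mem)
  have hconst : ∀ x : A, all x = x → ∀ i k : ι, g i ((Q i.1).proj x) = g k ((Q k.1).proj x) :=
    fun x hx i k => gt i k ((trace Q₀).proj ⟨x, hx⟩)
  let e := (Fintype.equivFin ι).symm
  refine ⟨Fintype.card ι, Fintype.card_pos, fun i x => g (e i) ((Q (e i).1).proj x),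
    fun i => g0 _, fun i x => gc (e i) ((Q (e i).1).proj x), fun i x hx y hy => ga _ _ (hmem _ hx) _ (hmem _ hy),
    fun i x hx => gb _ _ (hmem _ hx), fun x hx hx' => ⟨fun i => ?_, ?_, fun i k => ?_⟩,
    fun x hx hx' => ⟨fun i => ?_, ?_, fun i k => ?_⟩, ?_⟩
  · exact hmono' _ x hx _ hx' (le_ex x)
  · refine (e.surjective.exists (p := fun k =>
      g k ((Q k.1).proj x) = g k ((Q k.1).proj (ex x)))).1 ⟨⟨xᶜ, Finset.mem_insert_of_mem
      (Finset.mem_union_right _ (Finset.mem_image_of_mem _ hx))⟩, ?_⟩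
    refine le_antisymm (hmono' _ x hx _ hx' (le_ex x)) (hmono _ _ hx' _ hx ?_)
    have := hQw xᶜ
    rwa [all_compl, MVAlgebra.compl_compl, add_comm] at this
  · exact hconst _ (all_ex x) _ _
  · exact hmono' _ _ hx' _ hx (all_le x)
  · refine (e.surjective.exists (p := fun k =>
      g k ((Q k.1).proj x) = g k ((Q k.1).proj (all x)))).1 ⟨⟨x, Finset.mem_insert_of_mem (Finset.mem_union_left _ hx)⟩, ?_⟩
    exact le_antisymm (hmono _ _ hx _ hx' (hQw x)) (hmono' _ _ hx' _ hx (all_le x))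
  · exact hconst _ (all_all x) _ _
  · refine (e.surjective.exists (p := fun k =>
      g k ((Q k.1).proj s) ≠ g k ((Q k.1).proj t))).1 ⟨⟨sᶜ + t, Finset.mem_insert_self _ _⟩, ?_⟩
    -- If `s ≤ t` held modulo this filter, it would contain `s → t`, hence also `∀(s → t)`, which
    -- would then lie in `Q₀`.
    have hn : ¬ (Q (sᶜ + t)).proj s ≤ (Q (sᶜ + t)).proj t := fun h => hst₀
      ((hQ0 _ _ (all_all _)).1 ((Q _).mp (Filt.proj_le_proj _ |>.1 h) (hQw (sᶜ + t))))
    exact (glt _ _ (hmem _ ht) _ (hmem _ hs)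
      (lt_of_le_not_ge ((MVChain.total' _ _).resolve_left hn) hn)).ne'

end MonadicMVAlgebra

/-! ### Partial homomorphisms and quasi-identities -/

namespace FirstOrder.Language.Term

variable {L : FirstOrder.Language.{0, 0}} {A : Type*} [L.Structure A]

/-- The values of the subterms of a term. -/
def subvalues (v : ℕ → A) : L.Term ℕ → Set A
  | .var k => {v k}
  | .func f ts => insert ((func f ts).realize v) (⋃ i, subvalues v (ts i))

theorem finite_subvalues (v : ℕ → A) (t : L.Term ℕ) : (t.subvalues v).Finite := by
  induction t with
  | var k => exact Set.finite_singleton _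
  | func f ts ih => exact (Set.finite_iUnion ih).insert _

theorem realize_mem_subvalues (v : ℕ → A) (t : L.Term ℕ) : t.realize v ∈ t.subvalues v := by
  cases t with
  | var k => exact Set.mem_singleton _
  | func f ts => exact Set.mem_insert _ _

/-- Maps which preserve the operations inside a set preserve the terms with all values in it. -/
theorem realize_comp_of_subvalues_subset {B : Type*} [L.Structure B] {S : Set A} {φ : A → B}
    (hφ : ∀ {k : ℕ} (f : L.Functions k) (x : Fin k → A), (∀ i, x i ∈ S) →
      Structure.funMap f x ∈ S → φ (Structure.funMap f x) = Structure.funMap f (φ ∘ x))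
    (v : ℕ → A) (t : L.Term ℕ) (ht : t.subvalues v ⊆ S) :
    t.realize (φ ∘ v) = φ (t.realize v) := by
  induction t with
  | var k => rfl
  | func f ts ih =>
    have hts : ∀ i, (ts i).subvalues v ⊆ S := fun i =>
      (Set.subset_iUnion_of_subset i subset_rfl).trans ((Set.subset_insert _ _).trans ht)
    rw [realize_func, realize_func, hφ f _ (fun i => hts i (realize_mem_subvalues _ _))
      (ht (realize_mem_subvalues v (func f ts)))]
    congr 1
    funext i
    exact ih i (hts i)

end FirstOrder.Language.Term

/-- A quasi-identity holds in an algebra if it holds in a class of algebras which separates finite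
partial subalgebras. -/
theorem QuasiIdentity.holdsIn_of_separating {L : FirstOrder.Language.{0, 0}} {q : QuasiIdentity L}
    {A : CategoryTheory.Bundled.{u} L.Structure} {K : Set (CategoryTheory.Bundled.{u} L.Structure)}
    (hK : ∀ B ∈ K, q.HoldsIn B)
    (h : ∀ S : Set A, S.Finite → ∀ s ∈ S, ∀ t ∈ S, s ≠ t → ∃ B ∈ K, ∃ φ : A → B,
      (∀ {k : ℕ} (f : L.Functions k) (x : Fin k → A), (∀ i, x i ∈ S) →
        FirstOrder.Language.Structure.funMap f x ∈ S →
          φ (FirstOrder.Language.Structure.funMap f x) = FirstOrder.Language.Structure.funMap f (φ ∘ x)) ∧ φ s ≠ φ t) :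
    q.HoldsIn A := by
  intro v hv
  by_contra hne
  -- Values of all subterms are collected, so that a map preserving operations inside `S` commutes
  -- with the evaluation of every term of `q`.
  let S : Set A := (⋃ e ∈ {e | e ∈ q.premises}, e.1.subvalues v ∪ e.2.subvalues v) ∪
    (q.conclusion.1.subvalues v ∪ q.conclusion.2.subvalues v)
  have hfin : S.Finite := by
    refine ((List.finite_toSet q.premises).biUnion fun e _ => ?_).union ?_
    · exact (e.1.finite_subvalues v).union (e.2.finite_subvalues v)
    · exact (q.conclusion.1.finite_subvalues v).union (q.conclusion.2.finite_subvalues v)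
  have hc1 : q.conclusion.1.subvalues v ⊆ S := fun x hx => Or.inr (Or.inl hx)
  have hc2 : q.conclusion.2.subvalues v ⊆ S := fun x hx => Or.inr (Or.inr hx)
  obtain ⟨B, hB, φ, hφ, hst⟩ := h S hfin _ (hc1 (FirstOrder.Language.Term.realize_mem_subvalues v _)) _
    (hc2 (FirstOrder.Language.Term.realize_mem_subvalues v _)) hne
  refine hst ?_
  rw [← FirstOrder.Language.Term.realize_comp_of_subvalues_subset hφ v _ hc1,
    ← FirstOrder.Language.Term.realize_comp_of_subvalues_subset hφ v _ hc2]
  refine hK B hB (φ ∘ v) fun e he => ?_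
  rw [FirstOrder.Language.Term.realize_comp_of_subvalues_subset hφ v _ fun x hx =>
      Or.inl (Set.mem_biUnion he (Or.inl hx)),
    FirstOrder.Language.Term.realize_comp_of_subvalues_subset hφ v _ fun x hx =>
      Or.inl (Set.mem_biUnion he (Or.inr hx)), hv e he]

namespace MonadicMV

section Operations

variable {A : Type u} [language.Structure A]

theorem funMap_zero (x : Fin 0 → A) :
    FirstOrder.Language.Structure.funMap (L := language) Func.zero x = zero :=
  congrArg _ (Subsingleton.elim _ _)

theorem funMap_neg (x : Fin 1 → A) :
    FirstOrder.Language.Structure.funMap (L := language) Func.neg x = neg (x 0) :=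
  congrArg _ (funext fun i => by fin_cases i; rfl)

theorem funMap_oplus (x : Fin 2 → A) :
    FirstOrder.Language.Structure.funMap (L := language) Func.oplus x = oplus (x 0) (x 1) :=
  congrArg _ (funext fun i => by fin_cases i <;> rfl)

theorem funMap_ex (x : Fin 1 → A) :
    FirstOrder.Language.Structure.funMap (L := language) Func.ex x = ex (x 0) :=
  congrArg _ (funext fun i => by fin_cases i; rfl)

theorem funMap_all (x : Fin 1 → A) :
    FirstOrder.Language.Structure.funMap (L := language) Func.all x = all (x 0) :=
  congrArg _ (funext fun i => by fin_cases i; rfl)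

end Operations

/-! ### The class of monadic MV-algebras is a quasivariety -/

/-- The identity `s = t`. -/
def identity (s t : language.Term ℕ) : QuasiIdentity language := ⟨[], (s, t)⟩

theorem identity_holdsIn {s t : language.Term ℕ}
    {A : CategoryTheory.Bundled.{u} language.Structure} :
    (identity s t).HoldsIn A ↔ ∀ v : ℕ → A, s.realize v = t.realize v :=
  ⟨fun h v => h v (by simp [identity]), fun h v _ => h v⟩

/-- The term `0`. -/
def zeroT : language.Term ℕ := .func (L := language) Func.zero ![]

/-- The term `¬s`. -/
def negT (s : language.Term ℕ) : language.Term ℕ := .func (L := language) Func.neg ![s]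

/-- The term `s ⊕ t`. -/
def oplusT (s t : language.Term ℕ) : language.Term ℕ := .func (L := language) Func.oplus ![s, t]

/-- The term `∃s`. -/
def exT (s : language.Term ℕ) : language.Term ℕ := .func (L := language) Func.ex ![s]

/-- The term `∀s`. -/
def allT (s : language.Term ℕ) : language.Term ℕ := .func (L := language) Func.all ![s]

/-- The term `s → t`. -/
def impT (s t : language.Term ℕ) : language.Term ℕ := oplusT (negT s) t

/-- The term `s * t`. -/
def mulT (s t : language.Term ℕ) : language.Term ℕ := negT (oplusT (negT s) (negT t))

/-- The term `s ∨ t`. -/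
def supT (s t : language.Term ℕ) : language.Term ℕ := oplusT (negT (oplusT (negT s) t)) t

section Realize

variable {A : Type u} [language.Structure A] (v : ℕ → A) (s t : language.Term ℕ)

@[simp] theorem realize_zeroT : zeroT.realize v = zero := funMap_zero _

@[simp] theorem realize_negT : (negT s).realize v = neg (s.realize v) := funMap_neg _

@[simp] theorem realize_oplusT : (oplusT s t).realize v = oplus (s.realize v) (t.realize v) :=
  funMap_oplus _

@[simp] theorem realize_exT : (exT s).realize v = ex (s.realize v) := funMap_ex _

@[simp] theorem realize_allT : (allT s).realize v = all (s.realize v) := funMap_all _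

@[simp] theorem realize_impT : (impT s t).realize v = imp (s.realize v) (t.realize v) := by
  simp [impT, imp]

@[simp] theorem realize_mulT : (mulT s t).realize v = mul (s.realize v) (t.realize v) := by
  simp [mulT, mul]

@[simp] theorem realize_supT : (supT s t).realize v = sup (s.realize v) (t.realize v) := by
  simp [supT, sup]

end Realize

/-- The identities of monadic MV-algebras. -/
def axiomList : List (QuasiIdentity language) :=
  let x : language.Term ℕ := .var 0
  let y : language.Term ℕ := .var 1
  let z : language.Term ℕ := .var 2
  [identity (oplusT x (oplusT y z)) (oplusT (oplusT x y) z),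
    identity (oplusT x y) (oplusT y x),
    identity (oplusT x zeroT) x,
    identity (negT (negT x)) x,
    identity (oplusT x (negT zeroT)) (negT zeroT),
    identity (oplusT (negT (oplusT (negT x) y)) y) (oplusT (negT (oplusT (negT y) x)) x),
    identity (impT (allT x) x) (negT zeroT),
    identity (allT (impT x (allT y))) (impT (exT x) (allT y)),
    identity (allT (impT (allT x) y)) (impT (allT x) (allT y)),
    identity (allT (supT (exT x) y)) (supT (exT x) (allT y)),
    identity (exT (mulT x x)) (mulT (exT x) (exT x))]

theorem isQuasivariety_MMV : IsQuasivariety MMV.{u} := by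
  refine ⟨{q | q ∈ axiomList}, fun A => ?_⟩
  simp only [axiomList, Set.mem_ofPred_eq, List.forall_mem_cons, identity_holdsIn, MMV,
    realize_zeroT, realize_negT, realize_oplusT, realize_exT, realize_allT, realize_impT,
    realize_mulT, realize_supT, FirstOrder.Language.Term.realize_var]
  constructor
  · intro h
    exact ⟨fun v => h.oplus_assoc _ _ _, fun v => h.oplus_comm _ _, fun v => h.oplus_zero _,
      fun v => h.neg_neg _, fun v => h.oplus_neg_zero _, fun v => h.lukasiewicz _ _,
      fun v => h.m1 _, fun v => h.m2 _ _, fun v => h.m3 _ _, fun v => h.m4 _ _, fun v => h.m5 _,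
      by simp⟩
  · rintro ⟨h1, h2, h3, h4, h5, h6, h7, h8, h9, h10, h11, -⟩
    let v : A → A → A → ℕ → A := fun x y z k => if k = 0 then x else if k = 1 then y else z
    exact
      { oplus_assoc := fun x y z => h1 (v x y z)
        oplus_comm := fun x y => h2 (v x y y)
        oplus_zero := fun x => h3 (v x x x)
        neg_neg := fun x => h4 (v x x x)
        oplus_neg_zero := fun x => h5 (v x x x)
        lukasiewicz := fun x y => h6 (v x y y)
        m1 := fun x => h7 (v x x x)
        m2 := fun x y => h8 (v x y y)
        m3 := fun x y => h9 (v x y y)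
        m4 := fun x y => h10 (v x y y)
        m5 := fun x => h11 (v x x x) }

/-! ### The algebras `⟨Lₘⁿ, ∃_∨, ∀_∧⟩` -/

section Power

variable {m n : ℕ}

theorem val_sup_eq {f : Fin n → Chain m} {c : ℕ} (h : ∀ i, (f i : ℕ) ≤ c)
    (h' : ∃ i, (f i : ℕ) = c) : ((Finset.univ.sup f : Chain m) : ℕ) = c := by
  obtain ⟨i, rfl⟩ := h'
  exact congrArg Fin.val (le_antisymm (Finset.sup_le fun k _ => Fin.le_def.2 (h k))
    (Finset.le_sup (f := f) (Finset.mem_univ i)))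

theorem val_inf_eq {f : Fin n → Chain m} {c : ℕ} (h : ∀ i, c ≤ (f i : ℕ))
    (h' : ∃ i, (f i : ℕ) = c) : ((Finset.univ.inf f : Chain m) : ℕ) = c := by
  obtain ⟨i, rfl⟩ := h'
  exact congrArg Fin.val (le_antisymm (Finset.inf_le (f := f) (Finset.mem_univ i))
    (Finset.le_inf fun k _ => Fin.le_def.2 (h k)))

theorem exists_val_sup (hn : 1 ≤ n) (f : Fin n → Chain m) : ∃ c ≤ m,
    ((Finset.univ.sup f : Chain m) : ℕ) = c ∧ (∀ i, (f i : ℕ) ≤ c) ∧ ∃ i, (f i : ℕ) = c := by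
  have : Nonempty (Fin n) := ⟨⟨0, hn⟩⟩
  obtain ⟨i, hi⟩ := Finite.exists_max f
  exact ⟨f i, Fin.is_le _, val_sup_eq (fun k => Fin.le_def.1 (hi k)) ⟨i, rfl⟩,
    fun k => Fin.le_def.1 (hi k), i, rfl⟩

theorem exists_val_inf (hn : 1 ≤ n) (f : Fin n → Chain m) : ∃ c ≤ m,
    ((Finset.univ.inf f : Chain m) : ℕ) = c ∧ (∀ i, c ≤ (f i : ℕ)) ∧ ∃ i, (f i : ℕ) = c := by
  have : Nonempty (Fin n) := ⟨⟨0, hn⟩⟩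
  obtain ⟨i, hi⟩ := Finite.exists_min f
  exact ⟨f i, Fin.is_le _, val_inf_eq (fun k => Fin.le_def.1 (hi k)) ⟨i, rfl⟩,
    fun k => Fin.le_def.1 (hi k), i, rfl⟩

/-- The value of a coordinate of an element of `Lₘⁿ`, as a natural number. -/
def coord (x : power.{u} m n) (i : Fin n) : ℕ := (x.down i : ℕ)

theorem coord_le (x : power.{u} m n) (i : Fin n) : coord x i ≤ m := Fin.is_le _

theorem power_ext {x y : power.{u} m n} (h : ∀ i, coord x i = coord y i) : x = y :=
  ULift.ext _ _ (funext fun i => Fin.ext (h i))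

theorem coord_zero (i : Fin n) : coord (zero : power.{u} m n) i = 0 := rfl

theorem coord_neg (x : power.{u} m n) (i : Fin n) : coord (neg x) i = m - coord x i := rfl

theorem coord_oplus (x y : power.{u} m n) (i : Fin n) :
    coord (oplus x y) i = min (coord x i + coord y i) m := rfl

theorem coord_ex_eq {x : power.{u} m n} {c : ℕ} (h : ∀ i, coord x i ≤ c)
    (h' : ∃ i, coord x i = c) (i : Fin n) : coord (ex x) i = c := val_sup_eq h h'

theorem coord_all_eq {x : power.{u} m n} {c : ℕ} (h : ∀ i, c ≤ coord x i)
    (h' : ∃ i, coord x i = c) (i : Fin n) : coord (all x) i = c := val_inf_eq h h'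

theorem exists_coord_ex (hn : 1 ≤ n) (x : power.{u} m n) : ∃ c ≤ m,
    (∀ i, coord (ex x) i = c) ∧ (∀ i, coord x i ≤ c) ∧ ∃ i, coord x i = c := by
  obtain ⟨c, hc, h, h'⟩ := exists_val_sup hn x.down
  exact ⟨c, hc, fun _ => h, h'⟩

theorem exists_coord_all (hn : 1 ≤ n) (x : power.{u} m n) : ∃ c ≤ m,
    (∀ i, coord (all x) i = c) ∧ (∀ i, c ≤ coord x i) ∧ ∃ i, coord x i = c := by
  obtain ⟨c, hc, h, h'⟩ := exists_val_inf hn x.down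
  exact ⟨c, hc, fun _ => h, h'⟩

/-- For `n ≥ 1` suprema and infima are attained. In the quantifier axioms the operations are
monotone or antitone in each coordinate, so both sides can be computed at an extremal coordinate. -/
theorem power_mem_MMV (hn : 1 ≤ n) : power.{u} m n ∈ MMV.{u} := by
  refine IsMonadicMV.mk ⟨?_, ?_, ?_, ?_, ?_, ?_⟩ ?_ ?_ ?_ ?_ ?_
  · intro x y z
    refine power_ext fun i => ?_
    simp only [coord_oplus]
    omega
  · intro x y
    refine power_ext fun i => ?_
    simp only [coord_oplus]
    omega
  · intro x
    refine power_ext fun i => ?_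
    have := coord_le x i
    simp only [coord_oplus, coord_zero]
    omega
  · intro x
    refine power_ext fun i => ?_
    have := coord_le x i
    simp only [coord_neg]
    omega
  · intro x
    refine power_ext fun i => ?_
    simp only [coord_oplus, coord_neg, coord_zero]
    omega
  · intro x y
    refine power_ext fun i => ?_
    have := coord_le x i
    have := coord_le y i
    simp only [coord_oplus, coord_neg]
    omega
  · intro x
    refine power_ext fun i => ?_
    obtain ⟨c, hc, h, h', -⟩ := exists_coord_all hn x
    have := h' i
    simp only [imp, one, coord_oplus, coord_neg, coord_zero, h]
    omega
  · intro x y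
    obtain ⟨c, hc, h, h', k, hk⟩ := exists_coord_ex hn x
    obtain ⟨d, hd, g, -⟩ := exists_coord_all hn y
    refine power_ext fun i => ?_
    -- The constant is the value of the right-hand side, attained on the left at the coordinate `k`
    -- where `x` is largest.
    refine (coord_all_eq (c := min (m - c + d) m) (fun i => ?_) ⟨k, ?_⟩ i).trans ?_
    · have := h' i
      simp only [imp, coord_oplus, coord_neg, g]
      omega
    · simp only [imp, coord_oplus, coord_neg, g, hk]
    · simp only [imp, coord_oplus, coord_neg, g, h]
  · intro x y
    obtain ⟨c, hc, h, -⟩ := exists_coord_all hn x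
    obtain ⟨d, hd, g, g', k, hk⟩ := exists_coord_all hn y
    refine power_ext fun i => ?_
    refine (coord_all_eq (c := min (m - c + d) m) (fun i => ?_) ⟨k, ?_⟩ i).trans ?_
    · have := g' i
      simp only [imp, coord_oplus, coord_neg, h]
      omega
    · simp only [imp, coord_oplus, coord_neg, h, hk]
    · simp only [imp, coord_oplus, coord_neg, g, h]
  · intro x y
    obtain ⟨c, hc, h, -⟩ := exists_coord_ex hn x
    obtain ⟨d, hd, g, g', k, hk⟩ := exists_coord_all hn y
    refine power_ext fun i => ?_
    refine (coord_all_eq (c := min (m - min (m - c + d) m + d) m) (fun i => ?_) ⟨k, ?_⟩ i).trans ?_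
    · have := g' i
      simp only [sup, coord_oplus, coord_neg, h]
      omega
    · simp only [sup, coord_oplus, coord_neg, h, hk]
    · simp only [sup, coord_oplus, coord_neg, g, h]
  · intro x
    obtain ⟨c, hc, h, h', k, hk⟩ := exists_coord_ex hn x
    refine power_ext fun i => ?_
    refine (coord_ex_eq (c := m - min (m - c + (m - c)) m) (fun i => ?_) ⟨k, ?_⟩ i).trans ?_
    · have := h' i
      simp only [mul, coord_oplus, coord_neg]
      omega
    · simp only [mul, coord_oplus, coord_neg, hk]
    · simp only [mul, coord_oplus, coord_neg, h]

end Power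

/-! ### Finite partial embeddings into the powers. -/

/-- The abstract monadic MV-algebra of a model of the axioms. -/
abbrev IsMonadicMV.toMonadicMVAlgebra {A : Type u} [language.Structure A] (h : IsMonadicMV A) :
    MonadicMVAlgebra A where
  zero := zero
  add := oplus
  compl := neg
  nsmul := @nsmulRec A ⟨zero⟩ ⟨oplus⟩
  add_assoc x y z := (h.oplus_assoc x y z).symm
  add_comm := h.oplus_comm
  add_zero := h.oplus_zero
  zero_add x := (h.oplus_comm _ _).trans (h.oplus_zero x)
  compl_compl' := h.neg_neg
  add_compl_zero' := h.oplus_neg_zero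
  lukasiewicz' := h.lukasiewicz
  ex := ex
  all := all
  all_imp_self := h.m1
  all_imp_all := h.m2
  all_all_imp := h.m3
  all_ex_sup := h.m4
  ex_mul_self := h.m5

/-- Finite parts of monadic MV-algebras embed in some `⟨Lₘⁿ, ∃_∨, ∀_∧⟩`. -/
theorem exists_partial_embedding {A : Type u} [language.Structure A] (h : IsMonadicMV A)
    (S : Set A) (hS : S.Finite) {s t : A} (hs : s ∈ S) (ht : t ∈ S) (hst : s ≠ t) :
    ∃ m n : ℕ, 1 ≤ m ∧ 1 ≤ n ∧ ∃ φ : A → power.{u} m n,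
      (∀ {k : ℕ} (f : language.Functions k) (x : Fin k → A), (∀ i, x i ∈ S) →
        FirstOrder.Language.Structure.funMap f x ∈ S →
          φ (FirstOrder.Language.Structure.funMap f x) = FirstOrder.Language.Structure.funMap f (φ ∘ x)) ∧
      φ s ≠ φ t := by
  classical
  let := h.toMonadicMVAlgebra
  obtain ⟨n, hn, g, g0, gc, ga, gb, gex, gall, i₀, hi₀⟩ :=
    MonadicMVAlgebra.exists_rational_approx hS.toFinset (hS.mem_toFinset.2 hs)
      (hS.mem_toFinset.2 ht) hst
  simp only [hS.mem_toFinset] at ga gb gex gall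
  -- A common denominator: every `m * g i x` with `x ∈ S` is an integer between `0` and `m`.
  let m : ℕ := ∏ i, ∏ x ∈ hS.toFinset, (g i x).den
  have hm : 1 ≤ m := Finset.prod_pos fun i _ => Finset.prod_pos fun x _ => (g i x).den_pos
  have hmQ : (0 : ℚ) < m := by exact_mod_cast hm
  have hk : ∀ i, ∀ x ∈ S, ∃ k : Chain m, ((k : ℕ) : ℚ) = m * g i x := by
    intro i x hx
    have hdvd : (g i x).den ∣ m := (Finset.dvd_prod_of_mem _ (hS.mem_toFinset.2 hx)).trans
      (Finset.dvd_prod_of_mem (fun i => ∏ x ∈ hS.toFinset, (g i x).den) (Finset.mem_univ i))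
    obtain ⟨c, hc⟩ := hdvd
    obtain ⟨hg0, hg1⟩ := gb i x hx
    have hnum : (((g i x).num.toNat : ℕ) : ℤ) = (g i x).num :=
      Int.toNat_of_nonneg (Rat.num_nonneg.2 hg0)
    have hval : ((c * (g i x).num.toNat : ℕ) : ℚ) = m * g i x := by
      have h1 : (((g i x).num.toNat : ℕ) : ℚ) = (g i x).num := by exact_mod_cast hnum
      rw [hc, Nat.cast_mul, Nat.cast_mul, h1, mul_comm ((g i x).den : ℚ), mul_assoc,
        Rat.den_mul_eq_num]
    have hle : c * (g i x).num.toNat ≤ m := by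
      have : ((c * (g i x).num.toNat : ℕ) : ℚ) ≤ m := by
        rw [hval]
        exact mul_le_of_le_one_right hmQ.le hg1
      exact_mod_cast this
    exact ⟨⟨_, Nat.lt_succ_of_le hle⟩, hval⟩
  -- The default `0` is never used on `S`, the only set where the values of `φ` matter.
  let φ : A → power.{u} m n := fun x =>
    ⟨fun i => if hx : ∃ k : Chain m, ((k : ℕ) : ℚ) = m * g i x then hx.choose else 0⟩
  have hφ : ∀ x ∈ S, ∀ i, (coord (φ x) i : ℚ) = m * g i x := by
    intro x hx i
    have := hk i x hx
    simp only [coord, φ, dif_pos this]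
    exact this.choose_spec
  refine ⟨m, n, hm, hn, φ, ?_, fun heq => hi₀ ?_⟩
  · intro k f x hx hfx
    refine power_ext fun i => ?_
    cases f with
    | zero =>
      rw [funMap_zero] at hfx ⊢
      rw [funMap_zero, coord_zero]
      have := hφ _ hfx i
      rw [show g i zero = 0 from g0 i, mul_zero] at this
      exact_mod_cast this
    | neg =>
      rw [funMap_neg] at hfx ⊢
      rw [funMap_neg, coord_neg]
      have h1 := hφ _ hfx i
      have h2 := hφ _ (hx 0) i
      rw [show g i (neg (x 0)) = 1 - g i (x 0) from gc i _, mul_sub, mul_one, ← h2] at h1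
      have h3 : coord (φ (neg (x 0))) i + coord (φ (x 0)) i = m := by
        have : (coord (φ (neg (x 0))) i + coord (φ (x 0)) i : ℚ) = m := by rw [h1]; ring
        exact_mod_cast this
      exact Nat.eq_sub_of_add_eq h3
    | oplus =>
      rw [funMap_oplus] at hfx ⊢
      rw [funMap_oplus, coord_oplus]
      have h1 := hφ _ hfx i
      have h2 := hφ _ (hx 0) i
      have h3 := hφ _ (hx 1) i
      rw [show g i (oplus (x 0) (x 1)) = _ from ga i _ (hx 0) _ (hx 1),
        mul_min_of_nonneg _ _ hmQ.le, mul_add, mul_one, ← h2, ← h3] at h1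
      exact_mod_cast h1
    | ex =>
      rw [funMap_ex] at hfx ⊢
      rw [funMap_ex]
      obtain ⟨hle, ⟨k, hk⟩, hconst⟩ := gex _ (hx 0) hfx
      refine (coord_ex_eq (fun l => ?_) ⟨k, ?_⟩ i).symm
      · have : (coord (φ (x 0)) l : ℚ) ≤ coord (φ (ex (x 0))) i := by
          rw [hφ _ (hx 0), hφ _ hfx]
          exact mul_le_mul_of_nonneg_left ((hle l).trans (hconst l i).le) hmQ.le
        exact_mod_cast this
      · have : (coord (φ (x 0)) k : ℚ) = coord (φ (ex (x 0))) i := by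
          rw [hφ _ (hx 0), hφ _ hfx, hk]
          exact congrArg _ (hconst k i)
        exact_mod_cast this
    | all =>
      rw [funMap_all] at hfx ⊢
      rw [funMap_all]
      obtain ⟨hle, ⟨k, hk⟩, hconst⟩ := gall _ (hx 0) hfx
      refine (coord_all_eq (fun l => ?_) ⟨k, ?_⟩ i).symm
      · have : (coord (φ (all (x 0))) i : ℚ) ≤ coord (φ (x 0)) l := by
          rw [hφ _ (hx 0), hφ _ hfx]
          exact mul_le_mul_of_nonneg_left ((hconst i l).le.trans (hle l)) hmQ.le
        exact_mod_cast this
      · have : (coord (φ (x 0)) k : ℚ) = coord (φ (all (x 0))) i := by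
          rw [hφ _ (hx 0), hφ _ hfx, hk]
          exact congrArg _ (hconst k i)
        exact_mod_cast this
  · have h1 := hφ _ hs i₀
    rw [heq, hφ _ ht i₀] at h1
    exact (mul_left_cancel₀ hmQ.ne' h1).symm

end MonadicMV

/-- The variety of monadic MV-algebras is generated as a quasivariety by the finite algebras
`⟨Lₘⁿ, ∃_∨, ∀_∧⟩` with `m, n ≥ 1`. -/
theorem mainTheorem6 :
    IsGeneratedAsQuasivarietyBy MonadicMV.MMV.{u}
      {A | ∃ m n : ℕ, 1 ≤ m ∧ 1 ≤ n ∧ A = MonadicMV.power.{u} m n} := by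
  refine ⟨⟨MonadicMV.isQuasivariety_MMV, ?_⟩, ?_⟩
  · rintro _ ⟨m, n, -, hn, rfl⟩
    exact MonadicMV.power_mem_MMV hn
  · rintro Q ⟨⟨T, hT⟩, hK⟩ A hA
    refine (hT A).2 fun q hq => QuasiIdentity.holdsIn_of_separating
      (fun B hB => (hT B).1 (hK hB) q hq) fun S hS s hs t ht hst => ?_
    obtain ⟨m, n, hm, hn, φ, hφ⟩ := MonadicMV.exists_partial_embedding hA S hS hs ht hst
    exact ⟨_, ⟨m, n, hm, hn, rfl⟩, φ, hφ⟩
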